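/- **Setting.** For an integer $a\ge 1$ put $m(a)=3a+1$ and $\ell(a)=2a+1$. The building block $K(a)$ is the polygonal curve from $0$ to $1$ in the plane obtained by cutting $[0,1]$ into $\ell(a)$ equal intervals and replacing the 2nd, 4th, …, $2a$-th of them by the two other sides of the equilateral triangle erected on it, always on the same (left) side; it consists of $m(a)$ segments of length $\ell(a)^{-1}$ and has $a$ spikes. For a sequence $\xi=(\xi_n)_{n\ge1}$ of positive integers, $K(\xi)$ is the limit of the polygonal curves obtained by starting from $[0,1]$ and replacing, at iteration $n$, every linear piece by a scaled copy of $K(\xi_n)$. The scale-homogeneous snowflake $D=D(\xi)$ is the domain enclosed by the Jordan curve made of three copies of $K(\xi)$ placed on the sides of an equilateral triangle of side $1$ with the spikes pointing outwards. Write $\mu(\epsilon)$ for the area of $\{x\in D: d(x,\partial D)\le\epsilon\}$, and say that the inner Minkowski dimension $\dim_M\partial D$ exists and equals $\gamma$ if $$2-\limsup_{\epsilon\to0}\frac{\log\mu(\epsilon)}{\log\epsilon}=2-\liminf_{\epsilon\to0}\frac{\log\mu(\epsilon)}{\log\epsilon}=\gamma .$$ Put $\psi(x)=\sqrt{\log x\,\log\log\log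 x}$. **Theorem.** Let $A$ be a bounded set of positive integers and let $(\xi_n)_{n\ge1}$ be i.i.d. random variables with values in $A$. Then there are a (deterministic) real number $\gamma$ and (deterministic) constants $c_1,c_2,c_3>0$ such that, almost surely, $\dim_M\partial D$ exists and is equal to $\gamma$, and $$c_1\epsilon^{2-\gamma}e^{-c_2\psi(1/\epsilon)}\le\mu(\epsilon)\le c_3\epsilon^{2-\gamma}e^{c_2\psi(1/\epsilon)}\quad\text{for all small }\epsilon>0 .$$ Furthermore, if $\xi_1$ is not almost surely constant, then there is a constant $c_4>0$ such that, almost surely, $$\liminf_{\epsilon\to0}\frac{\mu(\epsilon)e^{c_4\psi(1/\epsilon)}}{\epsilon^{2-\gamma}}<\infty\quad\text{and}\quad\limsup_{\epsilon\to0}\frac{\mu(\epsilon)e^{-c_4\psi(1/\epsilon)}}{\epsilon^{2-\gamma}}>0 .$$ -/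

import Mathlib

open MeasureTheory ProbabilityTheory Filter Topology

noncomputable section

namespace Snowflake

/-! The plane is `ℂ`, with its Euclidean distance and its Lebesgue measure. -/

/-- The number `m(a) = 3a + 1` of linear pieces of the building block `K(a)`. -/
def numPieces (a : ℕ) : ℕ := 3 * a + 1

/-- The inverse `ℓ(a) = 2a + 1` of the length of the linear pieces of `K(a)`. -/
def scale (a : ℕ) : ℕ := 2 * a + 1

/-- The similarity of the plane, preserving orientation, that sends `0` to `p` and `1` to `q`. -/
def similarity (p q : ℂ) (z : ℂ) : ℂ := p + (q - p) * z

/-- The apex `e^{iπ/3}` of the equilateral triangle erected on the left of the segment from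
`0` to `1`. -/
def apex : ℂ := ⟨1 / 2, Real.sqrt 3 / 2⟩

/-- The consecutive vertices `v_0 = 0, v_1, …, v_{m(a)} = 1` of the building block `K(a)`.
The segment `[0, 1]` is cut into `ℓ(a) = 2a + 1` equal intervals, and every second one of them
(the 2nd, 4th, …, `2a`-th) is replaced by the two other sides of the equilateral triangle erected
on it, on the left of the segment; this gives `a` spikes, separated by flat pieces. -/
def blockVertex (a i : ℕ) : ℂ :=
  (2 * ((i / 3 : ℕ) : ℂ) +
    (if i % 3 = 0 then 0 else if i % 3 = 1 then 1 else 1 + apex)) / (scale a : ℂ)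

/-- The linear pieces, as pairs (initial point, final point), of the `n`-th iteration of the
construction: at each iteration every linear piece `(p, q)` is replaced by the copy of the next
building block with end points `p` and `q`. The sequence is indexed from `0`, so that `ξ n` is
used in the passage from iteration `n` to iteration `n + 1`. -/
def pieces (ξ : ℕ → ℕ) : ℕ → Set (ℂ × ℂ)
  | 0 => {(0, 1)}
  | n + 1 => {s | ∃ t ∈ pieces ξ n, ∃ i < numPieces (ξ n),
      s = (similarity t.1 t.2 (blockVertex (ξ n) i),
        similarity t.1 t.2 (blockVertex (ξ n) (i + 1)))}

/-- The polygonal curve obtained at the `n`-th iteration. -/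
def polygon (ξ : ℕ → ℕ) (n : ℕ) : Set ℂ := ⋃ s ∈ pieces ξ n, segment ℝ s.1 s.2

/-- The Koch curve `K(ξ)`: the limit of the polygonal curves, that is, the set of all limits of
sequences of points `z n ∈ polygon ξ n`. -/
def kochCurve (ξ : ℕ → ℕ) : Set ℂ :=
  {z | Tendsto (fun n => Metric.infDist z (polygon ξ n)) atTop (𝓝 0)}

/-- The third vertex `e^{-iπ/3}` of the equilateral triangle with vertices `0`, `1` that lies on
the right of the segment from `0` to `1`. -/
def thirdVertex : ℂ := ⟨1 / 2, -(Real.sqrt 3 / 2)⟩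

/-- The closed curve made of three copies of `K(ξ)`, put on the sides of an equilateral triangle
with the spikes pointing outwards (the triangle is run through clockwise). -/
def jordanCurve (ξ : ℕ → ℕ) : Set ℂ :=
  kochCurve ξ ∪ similarity 1 thirdVertex '' kochCurve ξ ∪ similarity thirdVertex 0 '' kochCurve ξ

/-- The set enclosed by `J`: the points of the complement of `J` whose connected component in
that complement is bounded. For a Jordan curve this is its interior domain. -/
def enclosed (J : Set ℂ) : Set ℂ :=
  {z | z ∈ Jᶜ ∧ Bornology.IsBounded (connectedComponentIn Jᶜ z)}

/-- The scale homogeneous snowflake `D(ξ)`. -/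
def snowflake (ξ : ℕ → ℕ) : Set ℂ := enclosed (jordanCurve ξ)

/-- The inner tubular volume `μ_D(ε)`: the area of the set of the points of `D` at distance
at most `ε` from the boundary of `D`. -/
def innerVolume (D : Set ℂ) (ε : ℝ) : ℝ :=
  (volume : Measure ℂ).real (Metric.cthickening ε (frontier D) ∩ D)

/-- The inner lower Minkowski dimension of the boundary of a plane domain `D`. -/
def innerLowerMinkowskiDim (D : Set ℂ) : EReal :=
  2 - limsup (fun ε : ℝ => ((Real.log (innerVolume D ε) / Real.log ε : ℝ) : EReal)) (𝓝[>] 0)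

/-- The inner upper Minkowski dimension of the boundary of a plane domain `D`. -/
def innerUpperMinkowskiDim (D : Set ℂ) : EReal :=
  2 - liminf (fun ε : ℝ => ((Real.log (innerVolume D ε) / Real.log ε : ℝ) : EReal)) (𝓝[>] 0)

/-- The inner Minkowski dimension of the boundary of `D` exists and is equal to `γ`. -/
def HasInnerMinkowskiDim (D : Set ℂ) (γ : ℝ) : Prop :=
  innerLowerMinkowskiDim D = (γ : EReal) ∧ innerUpperMinkowskiDim D = (γ : EReal)

/-- `ψ(x) = √(log x · log log log x)`. -/
def psi (x : ℝ) : ℝ := Real.sqrt (Real.log x * Real.log (Real.log (Real.log x)))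

end Snowflake

end

/-! Put M_n = ∏ m(ξ_k) and L_n = ∏ ℓ(ξ_k) over k < n (`totalPieces`, `totalScale`). When ε is
comparable to 1/L_n, the inner tube has area comparable to M_n / L_n². From above, the curve is
covered by 3 M_n discs of radius 1/L_n (`innerVolume_le`). From below, the first new spike on each
piece of one side contains a disc of comparable radius, and these M_n discs are disjoint
(`le_innerVolume`).

With S_n = ∑ (log m(ξ_k) − γ log ℓ(ξ_k)) one has M_n = e^{S_n} L_n^γ, so the area is comparable to
ε^{2−γ} e^{S_n}, uniformly over sequences bounded by B (`exists_innerVolume_bounds`). The choice γ =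
E log m(ξ_0) / E log ℓ(ξ_0) makes S_n a centred random walk with bounded steps. Since log L_n is of
order n, ψ(1/ε) is of order √(n log log n), and the theorem becomes a law of the iterated logarithm
with non-sharp constants. The walk is degenerate only if ξ_0 is constant, because
log(3a+1)/log(2a+1) is strictly decreasing (`strictAntiOn_log_div_log`).

The upper half of the law (`ae_eventually_sum_le`) uses Doob's inequality for the exponential
submartingale, dyadic times and Borel–Cantelli. The lower half (`ae_frequently_le_sum`) cuts
geometric blocks into about log k sub-blocks. By the central limit theorem each sub-block is large
with probability at least p, so the blocks are large with non-summable probabilities, and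
independence applies.

The geometry needs no Jordan curve theorem. The union of all triangles of the construction is
bounded with frontier on the curve (`frontier_iUnion_filled_subset`), hence is enclosed apart from
the curve (`diff_subset_enclosed`). Conversely the frontier of the domain lies on the curve
(`frontier_enclosed_subset`), and the curve has area zero (`volume_jordanCurve`). -/

noncomputable section

namespace Snowflake

/-! ### The building block -/

/-- The closed isosceles triangle with base `[0, 1]` and base angles `π / 6`, on the left. -/
def hull : Set ℂ := {z | 0 ≤ z.im ∧ √3 * z.im ≤ z.re ∧ √3 * z.im ≤ 1 - z.re}

/-- The interior of `hull`. -/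
def openHull : Set ℂ := {z | 0 < z.im ∧ √3 * z.im < z.re ∧ √3 * z.im < 1 - z.re}

/-- The closed equilateral triangle with base `[0, 1]`, on the right. -/
def rightTriangle : Set ℂ := {z | z.im ≤ 0 ∧ -z.im ≤ √3 * z.re ∧ -z.im ≤ √3 * (1 - z.re)}

theorem scale_pos (a : ℕ) : (0 : ℝ) < scale a := by
  unfold scale; positivity

theorem cast_scale (a : ℕ) : (scale a : ℝ) = 2 * a + 1 := by simp [scale]

theorem sqrt_three_sq : √3 * √3 = (3 : ℝ) := Real.mul_self_sqrt (by norm_num)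

theorem sqrt_three_gt : (1 : ℝ) < √3 := by
  rw [Real.lt_sqrt] <;> norm_num

theorem sqrt_three_lt : √3 < (2 : ℝ) := by
  rw [Real.sqrt_lt'] <;> norm_num

theorem blockVertex_zero_mod (a j : ℕ) : blockVertex a (3 * j) = (2 * j : ℂ) / (scale a : ℝ) := by
  simp [blockVertex]

theorem blockVertex_one_mod (a j : ℕ) :
    blockVertex a (3 * j + 1) = (2 * j + 1 : ℂ) / (scale a : ℝ) := by
  have h1 : (3 * j + 1) / 3 = j := by omega
  have h2 : (3 * j + 1) % 3 = 1 := by omega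
  simp [blockVertex, h1, h2]

theorem blockVertex_two_mod (a j : ℕ) :
    blockVertex a (3 * j + 2) = (2 * j + 1 + apex : ℂ) / (scale a : ℝ) := by
  have h1 : (3 * j + 2) / 3 = j := by omega
  have h2 : (3 * j + 2) % 3 = 2 := by omega
  simp [blockVertex, h1, h2, add_assoc]

theorem blockVertex_three_mod (a j : ℕ) :
    blockVertex a (3 * j + 3) = (2 * j + 2 : ℂ) / (scale a : ℝ) := by
  have := blockVertex_zero_mod a (j + 1)
  rw [show 3 * (j + 1) = 3 * j + 3 by ring] at this
  rw [this]; push_cast; ring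

theorem blockVertex_zero (a : ℕ) : blockVertex a 0 = 0 := by simp [blockVertex]

/-- The map that sends the unit segment to the `i`-th piece of the building block. -/
def child (a i : ℕ) (z : ℂ) : ℂ := similarity (blockVertex a i) (blockVertex a (i + 1)) z

section coordinates
variable (a j : ℕ) (z : ℂ)

theorem child_flat : child a (3 * j) z = (2 * j + z) / (scale a : ℝ) := by
  rw [child, similarity, blockVertex_zero_mod, blockVertex_one_mod]; ring

theorem child_up : child a (3 * j + 1) z = (2 * j + 1 + apex * z) / (scale a : ℝ) := by
  rw [child, similarity, blockVertex_two_mod, blockVertex_one_mod]; ring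

theorem child_down :
    child a (3 * j + 2) z = (2 * j + 1 + apex + (1 - apex) * z) / (scale a : ℝ) := by
  rw [child, similarity, blockVertex_two_mod, blockVertex_three_mod]; ring

theorem child_flat_re : (child a (3 * j) z).re = (2 * j + z.re) / scale a := by
  simp [child_flat]

theorem child_flat_im : (child a (3 * j) z).im = z.im / scale a := by
  simp [child_flat]

theorem child_up_re :
    (child a (3 * j + 1) z).re = (2 * j + 1 + (z.re / 2 - √3 / 2 * z.im)) / scale a := by
  simp [child_up, apex]; ring

theorem child_up_im :
    (child a (3 * j + 1) z).im = (z.im / 2 + √3 / 2 * z.re) / scale a := by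
  simp [child_up, apex]; ring

theorem child_down_re :
    (child a (3 * j + 2) z).re =
      (2 * j + 3 / 2 + (z.re / 2 + √3 / 2 * z.im)) / scale a := by
  simp [child_down, apex]; ring

theorem child_down_im :
    (child a (3 * j + 2) z).im = (√3 / 2 + (z.im / 2 - √3 / 2 * z.re)) / scale a := by
  simp [child_down, apex]; ring

end coordinates

/-- The three kinds of pieces of the building block. -/
theorem piece_cases {a i : ℕ} (hi : i < numPieces a) :
    (∃ j ≤ a, i = 3 * j) ∨ (∃ j < a, i = 3 * j + 1) ∨ (∃ j < a, i = 3 * j + 2) := by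
  unfold numPieces at hi
  have : i = 3 * (i / 3) ∨ i = 3 * (i / 3) + 1 ∨ i = 3 * (i / 3) + 2 := by omega
  rcases this with h | h | h
  · exact Or.inl ⟨i / 3, by omega, h⟩
  · exact Or.inr (Or.inl ⟨i / 3, by omega, h⟩)
  · exact Or.inr (Or.inr ⟨i / 3, by omega, h⟩)

/-- This nesting makes the covers of the curve decrease. The angle π/6 is the smallest possible: the
tip of the first spike lies on a side of `hull`. -/
theorem child_mem_hull {a i : ℕ} (hi : i < numPieces a) {z : ℂ} (hz : z ∈ hull) :
    child a i z ∈ hull := by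
  obtain ⟨h1, h2, h3⟩ := hz
  have hl := scale_pos a
  have h4 := sqrt_three_sq
  have h5 := sqrt_three_gt
  have h0 : 0 ≤ √3 * z.im := by positivity
  rcases piece_cases hi with ⟨j, hj, rfl⟩ | ⟨j, hj, rfl⟩ | ⟨j, hj, rfl⟩
  · have hj' : (j : ℝ) ≤ a := by exact_mod_cast hj
    have hj0 : (0 : ℝ) ≤ j := by positivity
    simp only [hull, Set.mem_ofPred_eq, child_flat_re, child_flat_im]
    refine ⟨by positivity, ?_, ?_⟩
    · rw [← mul_div_assoc]; gcongr; linarith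
    · rw [← mul_div_assoc, one_sub_div hl.ne', cast_scale]; gcongr; linarith
  · have hj' : (j : ℝ) + 1 ≤ a := by exact_mod_cast hj
    have hj0 : (0 : ℝ) ≤ j := by positivity
    simp only [hull, Set.mem_ofPred_eq, child_up_re, child_up_im]
    refine ⟨div_nonneg (by nlinarith) hl.le, ?_, ?_⟩
    · rw [← mul_div_assoc]; gcongr; linear_combination z.re / 2 * h4 + h3 + 2 * hj0
    · rw [← mul_div_assoc, one_sub_div hl.ne', cast_scale]; gcongr
      linear_combination z.re / 2 * h4 + 2 * hj' + 2 * h3 + 2 * h0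
  · have hj' : (j : ℝ) + 1 ≤ a := by exact_mod_cast hj
    have hj0 : (0 : ℝ) ≤ j := by positivity
    simp only [hull, Set.mem_ofPred_eq, child_down_re, child_down_im]
    refine ⟨div_nonneg (by nlinarith) hl.le, ?_, ?_⟩
    · rw [← mul_div_assoc]; gcongr
      linear_combination (1 - z.re) / 2 * h4 + 2 * hj0 + 2 * h2 + 2 * h0
    · rw [← mul_div_assoc, one_sub_div hl.ne', cast_scale]; gcongr
      linear_combination (1 - z.re) / 2 * h4 + 2 * hj' + h2

/-- Together with `child_openHull_disjoint`, this is the open set condition for the construction. -/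
theorem child_mem_openHull {a i : ℕ} (hi : i < numPieces a) {z : ℂ} (hz : z ∈ openHull) :
    child a i z ∈ openHull := by
  obtain ⟨h1, h2, h3⟩ := hz
  have hl := scale_pos a
  have h4 := sqrt_three_sq
  have h5 := sqrt_three_gt
  have h0 : 0 < √3 * z.im := by positivity
  rcases piece_cases hi with ⟨j, hj, rfl⟩ | ⟨j, hj, rfl⟩ | ⟨j, hj, rfl⟩
  · have hj' : (j : ℝ) ≤ a := by exact_mod_cast hj
    have hj0 : (0 : ℝ) ≤ j := by positivity
    simp only [openHull, Set.mem_ofPred_eq, child_flat_re, child_flat_im]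
    refine ⟨by positivity, ?_, ?_⟩
    · rw [← mul_div_assoc]; gcongr; linarith
    · rw [← mul_div_assoc, one_sub_div hl.ne', cast_scale]; gcongr; linarith
  · have hj' : (j : ℝ) + 1 ≤ a := by exact_mod_cast hj
    have hj0 : (0 : ℝ) ≤ j := by positivity
    simp only [openHull, Set.mem_ofPred_eq, child_up_re, child_up_im]
    refine ⟨div_pos (by nlinarith) hl, ?_, ?_⟩
    · rw [← mul_div_assoc]; gcongr; linear_combination z.re / 2 * h4 + h3 + 2 * hj0
    · rw [← mul_div_assoc, one_sub_div hl.ne', cast_scale]; gcongr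
      linear_combination z.re / 2 * h4 + 2 * hj' + 2 * h3 + 2 * h0
  · have hj' : (j : ℝ) + 1 ≤ a := by exact_mod_cast hj
    have hj0 : (0 : ℝ) ≤ j := by positivity
    simp only [openHull, Set.mem_ofPred_eq, child_down_re, child_down_im]
    refine ⟨div_pos (by nlinarith) hl, ?_, ?_⟩
    · rw [← mul_div_assoc]; gcongr
      linear_combination (1 - z.re) / 2 * h4 + 2 * hj0 + 2 * h2 + 2 * h0
    · rw [← mul_div_assoc, one_sub_div hl.ne', cast_scale]; gcongr
      linear_combination (1 - z.re) / 2 * h4 + 2 * hj' + h2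

/-- The open hulls of the pieces lie in disjoint vertical strips. -/
theorem child_re_mem {a i : ℕ} {z : ℂ} (hz : z ∈ openHull) :
    (blockVertex a i).re < (child a i z).re ∧ (child a i z).re < (blockVertex a (i + 1)).re := by
  obtain ⟨h1, h2, h3⟩ := hz
  have hl := scale_pos a
  have h4 := sqrt_three_sq
  have h5 := sqrt_three_gt
  have h0 : 0 < √3 * z.im := by positivity
  have : i = 3 * (i / 3) ∨ i = 3 * (i / 3) + 1 ∨ i = 3 * (i / 3) + 2 := by omega
  generalize i / 3 = j at this
  rcases this with rfl | rfl | rfl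
  · rw [child_flat_re, blockVertex_zero_mod, blockVertex_one_mod]
    simp only [Complex.div_ofReal_re]
    simp only [Complex.add_re, Complex.mul_re, Complex.natCast_re, Complex.natCast_im,
      Complex.one_re, Complex.re_ofNat, Complex.im_ofNat]
    constructor <;> refine div_lt_div_of_pos_right ?_ hl <;> linarith
  · rw [child_up_re, blockVertex_one_mod, blockVertex_two_mod]
    simp only [Complex.div_ofReal_re]
    simp only [Complex.add_re, Complex.mul_re, Complex.natCast_re, Complex.natCast_im,
      Complex.one_re, Complex.re_ofNat, Complex.im_ofNat, apex]
    constructor <;> refine div_lt_div_of_pos_right ?_ hl <;> linarith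
  · rw [child_down_re, blockVertex_two_mod, blockVertex_three_mod]
    simp only [Complex.div_ofReal_re]
    simp only [Complex.add_re, Complex.mul_re, Complex.natCast_re, Complex.natCast_im,
      Complex.one_re, Complex.re_ofNat, Complex.im_ofNat, apex]
    constructor <;> refine div_lt_div_of_pos_right ?_ hl <;> linarith

theorem openHull_nonempty : (openHull).Nonempty := by
  refine ⟨⟨1 / 2, 1 / 8⟩, ?_⟩
  have := sqrt_three_lt
  refine ⟨?_, ?_, ?_⟩ <;> norm_num <;> linarith

/-- Any point of the open hull of the i-th piece has abscissa strictly between those of the two end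
points. -/
theorem blockVertex_re_mono (a : ℕ) : Monotone fun i => (blockVertex a i).re := by
  refine monotone_nat_of_le_succ fun i => ?_
  obtain ⟨z, hz⟩ := openHull_nonempty
  obtain ⟨h1, h2⟩ := child_re_mem (a := a) (i := i) hz
  exact (h1.trans h2).le

theorem child_openHull_disjoint {a i i' : ℕ} {z z' : ℂ} (hz : z ∈ openHull) (hz' : z' ∈ openHull)
    (h : child a i z = child a i' z') : i = i' := by
  obtain ⟨h1, h2⟩ := child_re_mem (a := a) (i := i) hz
  obtain ⟨h1', h2'⟩ := child_re_mem (a := a) (i := i') hz'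
  rw [h] at h1 h2
  by_contra hne
  rcases lt_or_gt_of_ne hne with hlt | hlt
  · have := blockVertex_re_mono a (show i + 1 ≤ i' from hlt)
    dsimp only at this
    linarith
  · have := blockVertex_re_mono a (show i' + 1 ≤ i from hlt)
    dsimp only at this
    linarith

end Snowflake

namespace Snowflake

/-! ### Spikes -/

/-- The unit segment of the real axis. -/
def unitSegment : Set ℂ := {z | z.im = 0 ∧ 0 ≤ z.re ∧ z.re ≤ 1}

/-- The `j`-th spike of the building block, a closed equilateral triangle. -/
def spike (a j : ℕ) : Set ℂ :=
  {w | 0 ≤ w.im ∧ scale a * w.im ≤ √3 * (scale a * w.re - (2 * j + 1)) ∧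
    scale a * w.im ≤ √3 * (2 * j + 2 - scale a * w.re)}

/-- The union of the pieces of the building block. -/
def generator (a : ℕ) : Set ℂ := ⋃ i < numPieces a, child a i '' unitSegment

/-- The union of the right triangles on the pieces of the building block. -/
def childTriangles (a : ℕ) : Set ℂ := ⋃ i < numPieces a, child a i '' rightTriangle

theorem isClosed_hull : IsClosed hull := by
  rw [show hull = {z | 0 ≤ z.im} ∩ ({z | √3 * z.im ≤ z.re} ∩ {z | √3 * z.im ≤ 1 - z.re}) from rfl]
  refine (isClosed_le continuous_const Complex.continuous_im).inter
    ((isClosed_le ?_ ?_).inter (isClosed_le ?_ ?_)) <;> fun_prop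

theorem isClosed_rightTriangle : IsClosed rightTriangle := by
  rw [show rightTriangle = {z | z.im ≤ 0} ∩
    ({z | -z.im ≤ √3 * z.re} ∩ {z | -z.im ≤ √3 * (1 - z.re)}) from rfl]
  refine (isClosed_le Complex.continuous_im continuous_const).inter
    ((isClosed_le ?_ ?_).inter (isClosed_le ?_ ?_)) <;> fun_prop

theorem openHull_subset_hull : openHull ⊆ hull := fun _ h => ⟨h.1.le, h.2.1.le, h.2.2.le⟩

theorem unitSegment_subset_hull : unitSegment ⊆ hull := by
  rintro z ⟨h1, h2, h3⟩
  refine ⟨h1.ge, ?_, ?_⟩ <;> simp only [h1, mul_zero] <;> linarith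

theorem norm_le_one_of_mem_hull {z : ℂ} (hz : z ∈ hull) : ‖z‖ ≤ 1 := by
  obtain ⟨h1, h2, h3⟩ := hz
  have h4 := sqrt_three_sq
  have h5 := sqrt_three_gt
  rw [← sq_le_one_iff₀ (norm_nonneg z), Complex.sq_norm, Complex.normSq_apply]
  have h6 : z.im ≤ √3 * z.im := by nlinarith
  nlinarith

theorem norm_le_two_of_mem_rightTriangle {z : ℂ} (hz : z ∈ rightTriangle) : ‖z‖ ≤ 2 := by
  obtain ⟨h1, h2, h3⟩ := hz
  have h4 := sqrt_three_sq
  have h5 := sqrt_three_gt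
  rw [← sq_le_sq₀ (norm_nonneg z) (by norm_num), Complex.sq_norm, Complex.normSq_apply]
  have hx0 : 0 ≤ z.re := by
    by_contra! h; nlinarith
  have hx1 : z.re ≤ 1 := by
    by_contra! h; nlinarith
  have : -z.im ≤ √3 := by nlinarith
  nlinarith

theorem child_flat_mem_rightTriangle {a j : ℕ} (hj : j ≤ a) {z : ℂ} (hz : z ∈ rightTriangle) :
    child a (3 * j) z ∈ rightTriangle := by
  obtain ⟨h1, h2, h3⟩ := hz
  have hl := scale_pos a
  have h5 := sqrt_three_gt
  have hj' : (j : ℝ) ≤ a := by exact_mod_cast hj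
  have hj0 : (0 : ℝ) ≤ j := by positivity
  simp only [rightTriangle, Set.mem_ofPred_eq, child_flat_re, child_flat_im]
  refine ⟨div_nonpos_of_nonpos_of_nonneg h1 hl.le, ?_, ?_⟩
  · rw [← mul_div_assoc, ← neg_div]; gcongr; nlinarith
  · rw [one_sub_div hl.ne', ← mul_div_assoc, ← neg_div, cast_scale]; gcongr; nlinarith

/-- The equilateral triangle on the inner side of either side of a spike is the spike itself, so
filling in right triangles fills in the spikes. -/
theorem child_up_mem_spike {a j : ℕ} {z : ℂ} (hz : z ∈ rightTriangle) :
    child a (3 * j + 1) z ∈ spike a j := by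
  obtain ⟨h1, h2, h3⟩ := hz
  have hl := scale_pos a
  have h4 := sqrt_three_sq
  have h5 := sqrt_three_gt
  simp only [spike, Set.mem_ofPred_eq, child_up_re, child_up_im, mul_div_cancel₀ _ hl.ne']
  refine ⟨div_nonneg (by linarith) hl.le, ?_, ?_⟩
  · linear_combination 2 * h1 + z.im / 2 * h4
  · linear_combination h3 - z.im / 2 * h4

theorem child_down_mem_spike {a j : ℕ} {z : ℂ} (hz : z ∈ rightTriangle) :
    child a (3 * j + 2) z ∈ spike a j := by
  obtain ⟨h1, h2, h3⟩ := hz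
  have hl := scale_pos a
  have h4 := sqrt_three_sq
  have h5 := sqrt_three_gt
  simp only [spike, Set.mem_ofPred_eq, child_down_re, child_down_im, mul_div_cancel₀ _ hl.ne']
  refine ⟨div_nonneg (by linarith) hl.le, ?_, ?_⟩
  · linear_combination h2 - z.im / 2 * h4
  · linear_combination 2 * h1 + z.im / 2 * h4

theorem spike_subset_image_child_up (a j : ℕ) :
    spike a j ⊆ child a (3 * j + 1) '' rightTriangle := by
  rintro w ⟨h1, h2, h3⟩
  have hl := scale_pos a
  have h4 := sqrt_three_sq
  have h0 : 0 ≤ scale a * w.im := by positivity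
  set u := scale a * w.re - (2 * j + 1) with hu
  set y := scale a * w.im with hy
  replace h3 : y ≤ √3 * (1 - u) := h3.trans_eq (by rw [hu]; ring)
  clear_value u y
  refine ⟨⟨u / 2 + √3 / 2 * y, y / 2 - √3 / 2 * u⟩, ⟨?_, ?_, ?_⟩, Complex.ext ?_ ?_⟩
  · dsimp only; linarith
  · dsimp only; linear_combination 2 * h0 - y / 2 * h4
  · dsimp only; linear_combination h3 + y / 2 * h4
  · rw [child_up_re, div_eq_iff hl.ne']; linear_combination u / 4 * h4 + hu
  · rw [child_up_im, div_eq_iff hl.ne']; linear_combination y / 4 * h4 + hy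

theorem spike_subset_hull {a j : ℕ} (hj : j < a) : spike a j ⊆ hull := by
  rintro w ⟨h1, h2, h3⟩
  have hl := scale_pos a
  have h4 := sqrt_three_sq
  have h5 := sqrt_three_gt
  have hj' : (j : ℝ) + 1 ≤ a := by exact_mod_cast hj
  have hj0 : (0 : ℝ) ≤ j := by positivity
  have hs := cast_scale a
  have h6 : √3 * (scale a * w.im) ≤ √3 * (√3 * (scale a * w.re - (2 * j + 1))) := by gcongr
  have h7 : √3 * (scale a * w.im) ≤ √3 * (√3 * (2 * j + 2 - scale a * w.re)) := by gcongr
  rw [← mul_assoc √3 √3, h4] at h6 h7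
  refine ⟨h1, ?_, ?_⟩
  · refine le_of_mul_le_mul_left ?_ hl
    linarith
  · refine le_of_mul_le_mul_left ?_ hl
    linarith

/-- Flat pieces carry triangles inside the parent triangle; only the spikes add area, and they stay
in the hull. -/
theorem rightTriangle_child_subset {a i : ℕ} (hi : i < numPieces a) {z : ℂ}
    (hz : z ∈ rightTriangle) : child a i z ∈ rightTriangle ∪ hull := by
  rcases piece_cases hi with ⟨j, hj, rfl⟩ | ⟨j, hj, rfl⟩ | ⟨j, hj, rfl⟩
  · exact Or.inl (child_flat_mem_rightTriangle hj hz)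
  · exact Or.inr (spike_subset_hull hj (child_up_mem_spike hz))
  · exact Or.inr (spike_subset_hull hj (child_down_mem_spike hz))

theorem spike_subset_childTriangles {a j : ℕ} (hj : j < a) : spike a j ⊆ childTriangles a := by
  refine (spike_subset_image_child_up a j).trans ?_
  refine Set.subset_biUnion_of_mem (u := fun i => child a i '' rightTriangle) ?_
  change 3 * j + 1 < 3 * a + 1
  omega

/-- The open base of a spike stops being a boundary once the spike is added: the spike lies above it
and the old triangle below. -/
theorem base_subset_interior {a j : ℕ} (hj : j < a) {w : ℂ} (h0 : w.im = 0)
    (h1 : (2 * j + 1 : ℝ) < scale a * w.re) (h2 : scale a * w.re < 2 * j + 2) :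
    w ∈ interior (rightTriangle ∪ childTriangles a) := by
  have hl := scale_pos a
  have h5 := sqrt_three_gt
  have hj' : (j : ℝ) + 1 ≤ a := by exact_mod_cast hj
  have hj0 : (0 : ℝ) ≤ j := by positivity
  have hs := cast_scale a
  -- The open rhombus formed by the spike and its mirror image in the real axis.
  let V : Set ℂ := {w | |scale a * w.im| < √3 * (scale a * w.re - (2 * j + 1))} ∩
    {w | |scale a * w.im| < √3 * (2 * j + 2 - scale a * w.re)}
  have hV : IsOpen V := by
    refine (isOpen_lt ?_ ?_).inter (isOpen_lt ?_ ?_) <;> fun_prop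
  refine mem_interior.2 ⟨V, ?_, hV, ?_⟩
  · rintro z ⟨hz1, hz2⟩
    simp only [Set.mem_ofPred_eq, abs_lt] at hz1 hz2
    rcases le_total 0 z.im with hz | hz
    · exact Or.inr (spike_subset_childTriangles hj ⟨hz, hz1.2.le, hz2.2.le⟩)
    · refine Or.inl ⟨hz, ?_, ?_⟩
      · refine le_of_mul_le_mul_left ?_ hl
        nlinarith
      · refine le_of_mul_le_mul_left ?_ hl
        nlinarith
  · constructor
    · simp only [Set.mem_ofPred_eq, h0, mul_zero, abs_zero]
      exact mul_pos (by linarith) (by linarith)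
    · simp only [Set.mem_ofPred_eq, h0, mul_zero, abs_zero]
      exact mul_pos (by linarith) (by linarith)

theorem mem_generator {a i : ℕ} (hi : i < numPieces a) {z : ℂ} (hz : z ∈ unitSegment) :
    child a i z ∈ generator a :=
  Set.mem_biUnion (t := fun i => child a i '' unitSegment) hi ⟨z, hz, rfl⟩

/-- An even interval of the subdivision, counted from 0, is a flat piece of the generator; an odd
one is the base of a spike. This drives the induction in `frontier_filled_subset`. -/
theorem unitSegment_subset (a : ℕ) :
    unitSegment ⊆ generator a ∪ interior (rightTriangle ∪ childTriangles a) := by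
  rintro z ⟨h1, h2, h3⟩
  have hl := scale_pos a
  have hs := cast_scale a
  have hx0 : 0 ≤ scale a * z.re := by positivity
  have hx1 : scale a * z.re ≤ 2 * a + 1 := by nlinarith
  have flat : ∀ j ≤ a, (2 * j : ℝ) ≤ scale a * z.re → scale a * z.re ≤ 2 * j + 1 →
      z ∈ generator a := by
    intro j hj h h'
    have : child a (3 * j) ⟨scale a * z.re - 2 * j, 0⟩ = z := by
      refine Complex.ext ?_ ?_
      · rw [child_flat_re, div_eq_iff hl.ne']; dsimp only; ring
      · rw [child_flat_im, h1]; simp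
    rw [← this]
    exact mem_generator (by unfold numPieces; omega)
      ⟨rfl, by dsimp only; linarith, by dsimp only; linarith⟩
  have hk1 := Nat.floor_le hx0
  have hk2 := Nat.lt_floor_add_one (scale a * z.re)
  generalize ⌊scale a * z.re⌋₊ = k at hk1 hk2
  have hk : k ≤ 2 * a + 1 := by
    have : (k : ℝ) ≤ 2 * a + 1 := hk1.trans hx1
    exact_mod_cast this
  obtain ⟨j, hj | hj⟩ : ∃ j, k = 2 * j ∨ k = 2 * j + 1 := ⟨k / 2, by omega⟩
  · subst hj
    push_cast at hk1 hk2
    exact Or.inl (flat j (by omega) hk1 hk2.le)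
  · subst hj
    push_cast at hk1 hk2
    rcases hk1.eq_or_lt with h | h
    · exact Or.inl (flat j (by omega) (by linarith) h.ge)
    · rcases (show j ≤ a by omega).eq_or_lt with rfl | hja
      · linarith
      · exact Or.inr (base_subset_interior hja h1 h (by linarith))

theorem spike_subset {a j : ℕ} (hj : j < a) :
    spike a j ⊆ generator a ∪ rightTriangle ∪ interior (spike a j) := by
  rintro w ⟨h1, h2, h3⟩
  have hl := scale_pos a
  have h4 := sqrt_three_sq
  have h5 := sqrt_three_gt
  have hj' : (j : ℝ) + 1 ≤ a := by exact_mod_cast hj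
  have hj0 : (0 : ℝ) ≤ j := by positivity
  have hs := cast_scale a
  have h0 : 0 ≤ scale a * w.im := by positivity
  have hb : 0 ≤ scale a * w.re - (2 * j + 1) := by
    by_contra! h; nlinarith
  have hb' : 0 ≤ 2 * j + 2 - scale a * w.re := by
    by_contra! h; nlinarith
  rcases h1.eq_or_lt with h1' | h1'
  · refine Or.inl (Or.inr ⟨h1'.ge, ?_, ?_⟩)
    · rw [← h1', neg_zero]
      have : 0 ≤ w.re := by
        refine le_of_mul_le_mul_left ?_ hl
        linarith
      positivity
    · rw [← h1', neg_zero]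
      have : w.re ≤ 1 := by
        refine le_of_mul_le_mul_left ?_ hl
        linarith
      exact mul_nonneg (by linarith) (by linarith)
  rcases h2.eq_or_lt with h2' | h2'
  · refine Or.inl (Or.inl ?_)
    have : child a (3 * j + 1) ⟨2 * (scale a * w.re - (2 * j + 1)), 0⟩ = w := by
      refine Complex.ext ?_ ?_
      · rw [child_up_re, div_eq_iff hl.ne']; dsimp only; ring
      · rw [child_up_im, div_eq_iff hl.ne']; dsimp only; linarith
    rw [← this]
    refine mem_generator (by unfold numPieces; omega) ⟨rfl, by dsimp only; linarith, ?_⟩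
    dsimp only; nlinarith
  rcases h3.eq_or_lt with h3' | h3'
  · refine Or.inl (Or.inl ?_)
    have : child a (3 * j + 2) ⟨2 * (scale a * w.re - (2 * j + 1)) - 1, 0⟩ = w := by
      refine Complex.ext ?_ ?_
      · rw [child_down_re, div_eq_iff hl.ne']; dsimp only; ring
      · rw [child_down_im, div_eq_iff hl.ne']; dsimp only; linarith
    rw [← this]
    refine mem_generator (by unfold numPieces; omega) ⟨rfl, ?_, by dsimp only; linarith⟩
    dsimp only; nlinarith
  · right
    refine mem_interior.2 ⟨{w | 0 < w.im} ∩
      ({w | scale a * w.im < √3 * (scale a * w.re - (2 * j + 1))} ∩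
      {w | scale a * w.im < √3 * (2 * j + 2 - scale a * w.re)}), ?_, ?_, h1', h2', h3'⟩
    · exact fun z hz => ⟨hz.1.le, hz.2.1.le, hz.2.2.le⟩
    · refine (isOpen_lt ?_ ?_).inter ((isOpen_lt ?_ ?_).inter (isOpen_lt ?_ ?_)) <;> fun_prop

theorem childTriangles_subset (a : ℕ) :
    childTriangles a ⊆ rightTriangle ∪ generator a ∪ interior (childTriangles a) := by
  intro w hw
  obtain ⟨i, hi, z, hz, rfl⟩ := Set.mem_iUnion₂.1 hw
  have key : ∀ j < a, child a i z ∈ spike a j →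
      child a i z ∈ rightTriangle ∪ generator a ∪ interior (childTriangles a) := by
    intro j hj h
    rcases spike_subset hj h with (h | h) | h
    · exact Or.inl (Or.inr h)
    · exact Or.inl (Or.inl h)
    · exact Or.inr (interior_mono (spike_subset_childTriangles hj) h)
  rcases piece_cases hi with ⟨j, hj, rfl⟩ | ⟨j, hj, rfl⟩ | ⟨j, hj, rfl⟩
  · exact Or.inl (Or.inl (child_flat_mem_rightTriangle hj hz))
  · exact key j hj (child_up_mem_spike hz)
  · exact key j hj (child_down_mem_spike hz)

/-- The centre of a disc contained in the first spike. -/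
def spikeCenter (a : ℕ) : ℂ := ⟨3 / 2 / scale a, 1 / 4 / scale a⟩

/-- Lying in `openHull` makes the discs of different pieces disjoint; lying in the spike puts them
in the domain, up to the curve. -/
theorem ball_spikeCenter_subset {a : ℕ} (ha : 1 ≤ a) :
    Metric.ball (spikeCenter a) (1 / (8 * scale a)) ⊆ openHull ∩ spike a 0 := by
  intro w hw
  have hl := scale_pos a
  have hs := cast_scale a
  have ha' : (1 : ℝ) ≤ a := by exact_mod_cast ha
  have h5 := sqrt_three_gt
  have h6 := sqrt_three_lt
  rw [Metric.mem_ball, dist_eq_norm] at hw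
  have hre := (Complex.abs_re_le_norm _).trans_lt hw
  have him := (Complex.abs_im_le_norm _).trans_lt hw
  rw [Complex.sub_re, spikeCenter] at hre
  rw [Complex.sub_im, spikeCenter] at him
  dsimp only at hre him
  rw [lt_div_iff₀ (by positivity), ← abs_of_pos (show (0 : ℝ) < 8 * scale a by positivity),
    ← abs_mul, abs_lt] at hre him
  have e1 : (w.re - 3 / 2 / scale a) * (8 * scale a) = 8 * (scale a * w.re) - 12 := by
    field_simp; ring
  have e2 : (w.im - 1 / 4 / scale a) * (8 * scale a) = 8 * (scale a * w.im) - 2 := by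
    field_simp; ring
  rw [e1] at hre
  rw [e2] at him
  have hy : 0 < scale a * w.im := by linarith
  have hy' : 0 < w.im := pos_of_mul_pos_right hy hl.le
  refine ⟨⟨hy', ?_, ?_⟩, hy'.le, ?_, ?_⟩
  · refine lt_of_mul_lt_mul_left ?_ hl.le
    nlinarith
  · refine lt_of_mul_lt_mul_left ?_ hl.le
    nlinarith
  · push_cast; nlinarith
  · push_cast; nlinarith

/-! ### The base triangle -/

theorem similarity_base_one (z : ℂ) : similarity 1 thirdVertex z =
    ⟨1 - z.re / 2 + √3 / 2 * z.im, -(z.im / 2) - √3 / 2 * z.re⟩ := by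
  apply Complex.ext <;> simp [similarity, thirdVertex] <;> ring

theorem similarity_base_two (z : ℂ) : similarity thirdVertex 0 z =
    ⟨1 / 2 - z.re / 2 - √3 / 2 * z.im, -(√3 / 2) + √3 / 2 * z.re - z.im / 2⟩ := by
  apply Complex.ext <;> simp [similarity, thirdVertex] <;> ring

/-- The map is the rotation by a third of a turn about the centre of the triangle, so the three
sides at iteration 0 all carry the same right triangle. -/
theorem similarity_base_one_mem {z : ℂ} (hz : z ∈ rightTriangle) :
    similarity 1 thirdVertex z ∈ rightTriangle := by
  obtain ⟨h1, h2, h3⟩ := hz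
  have h4 := sqrt_three_sq
  rw [similarity_base_one]
  refine ⟨?_, ?_, ?_⟩ <;> dsimp only
  · linarith
  · linear_combination h3 - z.im / 2 * h4
  · linear_combination 2 * h1 + z.im / 2 * h4

theorem similarity_base_two_mem {z : ℂ} (hz : z ∈ rightTriangle) :
    similarity thirdVertex 0 z ∈ rightTriangle := by
  obtain ⟨h1, h2, h3⟩ := hz
  have h4 := sqrt_three_sq
  rw [similarity_base_two]
  refine ⟨?_, ?_, ?_⟩ <;> dsimp only
  · linarith
  · linear_combination 2 * h1 + z.im / 2 * h4
  · linear_combination h2 - z.im / 2 * h4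

theorem frontier_rightTriangle_subset : frontier rightTriangle ⊆
    unitSegment ∪ similarity 1 thirdVertex '' unitSegment ∪
      similarity thirdVertex 0 '' unitSegment := by
  intro w hw
  rw [isClosed_rightTriangle.frontier_eq] at hw
  obtain ⟨⟨h1, h2, h3⟩, hw⟩ := hw
  have h4 := sqrt_three_sq
  have h5 := sqrt_three_gt
  have hx0 : 0 ≤ w.re := by
    by_contra! h; nlinarith
  have hx1 : w.re ≤ 1 := by
    by_contra! h; nlinarith
  rcases h1.eq_or_lt with h1' | h1'
  · exact Or.inl (Or.inl ⟨h1', hx0, hx1⟩)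
  rcases h3.eq_or_lt with h3' | h3'
  · refine Or.inl (Or.inr ⟨⟨2 * (1 - w.re), 0⟩, ⟨rfl, ?_, ?_⟩, ?_⟩)
    · dsimp only; linarith
    · dsimp only; nlinarith
    · rw [similarity_base_one]
      apply Complex.ext <;> dsimp only <;> linarith
  rcases h2.eq_or_lt with h2' | h2'
  · refine Or.inr ⟨⟨1 - 2 * w.re, 0⟩, ⟨rfl, ?_, ?_⟩, ?_⟩
    · dsimp only; nlinarith
    · dsimp only; linarith
    · rw [similarity_base_two]
      apply Complex.ext <;> dsimp only <;> linarith
  · refine absurd (mem_interior.2 ⟨{w | w.im < 0} ∩ ({w | -w.im < √3 * w.re} ∩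
      {w | -w.im < √3 * (1 - w.re)}), ?_, ?_, h1', h2', h3'⟩) hw
    · exact fun z hz => ⟨hz.1.le, hz.2.1.le, hz.2.2.le⟩
    · refine (isOpen_lt ?_ ?_).inter ((isOpen_lt ?_ ?_).inter (isOpen_lt ?_ ?_)) <;> fun_prop

end Snowflake

namespace Snowflake

/-! ### Similarities -/

theorem similarity_similarity (p q u v z : ℂ) :
    similarity (similarity p q u) (similarity p q v) z = similarity p q (similarity u v z) := by
  simp only [similarity]; ring

theorem similarity_zero_one (z : ℂ) : similarity 0 1 z = z := by simp [similarity]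

theorem similarity_zero (p q : ℂ) : similarity p q 0 = p := by simp [similarity]

theorem similarity_one (p q : ℂ) : similarity p q 1 = q := by simp [similarity]

theorem dist_similarity (p q z w : ℂ) :
    dist (similarity p q z) (similarity p q w) = ‖q - p‖ * dist z w := by
  rw [dist_eq_norm, dist_eq_norm, ← norm_mul]; congr 1; simp only [similarity]; ring

theorem continuous_similarity (p q : ℂ) : Continuous (similarity p q) := by
  unfold similarity; fun_prop

theorem similarity_injective {p q : ℂ} (h : p ≠ q) : Function.Injective (similarity p q) := by
  intro z w hzw
  have h' : q - p ≠ 0 := sub_ne_zero.2 h.symm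
  simpa [similarity, h'] using hzw

/-- The similarity as a homeomorphism. -/
def similarityHomeomorph {p q : ℂ} (h : p ≠ q) : ℂ ≃ₜ ℂ :=
  (Homeomorph.mulLeft₀ (q - p) (sub_ne_zero.2 h.symm)).trans (Homeomorph.addLeft p)

theorem image_interior_similarity {p q : ℂ} (h : p ≠ q) (s : Set ℂ) :
    similarity p q '' interior s = interior (similarity p q '' s) :=
  (similarityHomeomorph h).image_interior s

theorem segment_eq_image_similarity (p q : ℂ) :
    segment ℝ p q = similarity p q '' unitSegment := by
  rw [segment_eq_image']
  ext w
  constructor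
  · rintro ⟨θ, ⟨h0, h1⟩, rfl⟩
    refine ⟨θ, ⟨by simp, by simpa using h0, by simpa using h1⟩, ?_⟩
    simp [similarity, mul_comm]
  · rintro ⟨z, ⟨h0, h1, h2⟩, rfl⟩
    refine ⟨z.re, ⟨h1, h2⟩, ?_⟩
    have : (z.re : ℂ) = z := Complex.ext (by simp) (by simp [h0])
    simp [similarity, this, mul_comm]

theorem zero_mem_unitSegment : (0 : ℂ) ∈ unitSegment := by simp [unitSegment]

/-! ### Pieces -/

/-- The copy of a set placed on a piece. -/
def place (s : ℂ × ℂ) (S : Set ℂ) : Set ℂ := similarity s.1 s.2 '' S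

/-- The `i`-th piece that replaces the piece `t`. -/
def childPiece (a : ℕ) (t : ℂ × ℂ) (i : ℕ) : ℂ × ℂ :=
  (similarity t.1 t.2 (blockVertex a i), similarity t.1 t.2 (blockVertex a (i + 1)))

theorem similarity_childPiece (a : ℕ) (t : ℂ × ℂ) (i : ℕ) (z : ℂ) :
    similarity (childPiece a t i).1 (childPiece a t i).2 z =
      similarity t.1 t.2 (child a i z) := by
  rw [child, childPiece, similarity_similarity]

theorem place_childPiece (a : ℕ) (t : ℂ × ℂ) (i : ℕ) (S : Set ℂ) :
    place (childPiece a t i) S = place t (child a i '' S) := by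
  simp only [place, Set.image_image, similarity_childPiece]

theorem place_mono (s : ℂ × ℂ) {S T : Set ℂ} (h : S ⊆ T) : place s S ⊆ place s T :=
  Set.image_mono h

theorem place_union (s : ℂ × ℂ) (S T : Set ℂ) : place s (S ∪ T) = place s S ∪ place s T :=
  Set.image_union _ _ _

theorem norm_apex : ‖apex‖ = 1 := by
  rw [← sq_eq_sq₀ (norm_nonneg _) zero_le_one, Complex.sq_norm, Complex.normSq_apply]
  have := sqrt_three_sq
  simp only [apex]; linarith

theorem norm_one_sub_apex : ‖1 - apex‖ = 1 := by
  rw [← sq_eq_sq₀ (norm_nonneg _) zero_le_one, Complex.sq_norm, Complex.normSq_apply]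
  have := sqrt_three_sq
  simp only [apex, Complex.sub_re, Complex.sub_im, Complex.one_re, Complex.one_im]; linarith

theorem norm_blockVertex_sub (a i : ℕ) :
    ‖blockVertex a (i + 1) - blockVertex a i‖ = (scale a : ℝ)⁻¹ := by
  have hl := scale_pos a
  have : i = 3 * (i / 3) ∨ i = 3 * (i / 3) + 1 ∨ i = 3 * (i / 3) + 2 := by omega
  generalize i / 3 = j at this
  rcases this with rfl | rfl | rfl
  · rw [blockVertex_one_mod, blockVertex_zero_mod, ← sub_div, norm_div, Complex.norm_real,
      Real.norm_of_nonneg hl.le, add_sub_cancel_left, norm_one, one_div]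
  · rw [blockVertex_two_mod, blockVertex_one_mod, ← sub_div, norm_div, Complex.norm_real,
      Real.norm_of_nonneg hl.le, add_sub_cancel_left, norm_apex, one_div]
  · rw [blockVertex_three_mod, blockVertex_two_mod, ← sub_div, norm_div, Complex.norm_real,
      Real.norm_of_nonneg hl.le, show (2 * j + 2 - (2 * j + 1 + apex) : ℂ) = 1 - apex by ring,
      norm_one_sub_apex, one_div]

theorem norm_childPiece (a : ℕ) (t : ℂ × ℂ) (i : ℕ) :
    ‖(childPiece a t i).2 - (childPiece a t i).1‖ = ‖t.2 - t.1‖ * (scale a : ℝ)⁻¹ := by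
  rw [← dist_eq_norm, childPiece, dist_similarity, dist_eq_norm, norm_blockVertex_sub]

variable (ξ : ℕ → ℕ)

/-- The inverse of the length of the pieces at iteration `n`. -/
def totalScale (n : ℕ) : ℝ := ∏ k ∈ Finset.range n, (scale (ξ k) : ℝ)

/-- The number of pieces at iteration `n`. -/
def totalPieces (n : ℕ) : ℕ := ∏ k ∈ Finset.range n, numPieces (ξ k)

theorem totalScale_pos (n : ℕ) : 0 < totalScale ξ n :=
  Finset.prod_pos fun _ _ => scale_pos _

theorem totalScale_succ (n : ℕ) :
    totalScale ξ (n + 1) = totalScale ξ n * scale (ξ n) := Finset.prod_range_succ _ _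

theorem mem_pieces_succ {n : ℕ} {s : ℂ × ℂ} : s ∈ pieces ξ (n + 1) ↔
    ∃ t ∈ pieces ξ n, ∃ i < numPieces (ξ n), s = childPiece (ξ n) t i := Iff.rfl

variable {ξ}

theorem norm_of_mem_pieces {n : ℕ} {s : ℂ × ℂ} (hs : s ∈ pieces ξ n) :
    ‖s.2 - s.1‖ = (totalScale ξ n)⁻¹ := by
  induction n generalizing s with
  | zero =>
    obtain rfl : s = (0, 1) := hs
    simp [totalScale]
  | succ n ih =>
    obtain ⟨t, ht, i, hi, rfl⟩ := hs
    rw [← childPiece, norm_childPiece, ih ht, totalScale_succ, mul_inv]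

theorem ne_of_mem_pieces {n : ℕ} {s : ℂ × ℂ} (hs : s ∈ pieces ξ n) : s.1 ≠ s.2 := by
  intro h
  have := norm_of_mem_pieces hs
  rw [h, sub_self, norm_zero] at this
  exact (inv_pos.2 (totalScale_pos ξ n)).ne this

/-- A common point also lies in the open hulls of the two parents, which agree by induction; undoing
the parent's similarity reduces the claim to one building block. -/
theorem eq_of_similarity_eq {n : ℕ} {s s' : ℂ × ℂ} (hs : s ∈ pieces ξ n) (hs' : s' ∈ pieces ξ n)
    {z z' : ℂ} (hz : z ∈ openHull) (hz' : z' ∈ openHull)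
    (h : similarity s.1 s.2 z = similarity s'.1 s'.2 z') : s = s' := by
  induction n generalizing s s' z z' with
  | zero => exact (show s = (0, 1) from hs).trans (show s' = (0, 1) from hs').symm
  | succ n ih =>
    obtain ⟨t, ht, i, hi, rfl⟩ := hs
    obtain ⟨t', ht', i', hi', rfl⟩ := hs'
    rw [← childPiece, ← childPiece, similarity_childPiece, similarity_childPiece] at h
    obtain rfl := ih ht ht' (child_mem_openHull hi hz) (child_mem_openHull hi' hz') h
    rw [child_openHull_disjoint hz hz' (similarity_injective (ne_of_mem_pieces ht) h)]

variable (ξ)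

open Classical in
/-- The pieces at iteration `n`, as a finite set. -/
def pieceFinset : ℕ → Finset (ℂ × ℂ)
  | 0 => {(0, 1)}
  | n + 1 => (pieceFinset n).biUnion fun t =>
      (Finset.range (numPieces (ξ n))).image (childPiece (ξ n) t)

variable {ξ}

theorem mem_pieceFinset {n : ℕ} {s : ℂ × ℂ} : s ∈ pieceFinset ξ n ↔ s ∈ pieces ξ n := by
  induction n generalizing s with
  | zero => simp [pieceFinset, pieces]
  | succ n ih =>
    simp only [pieceFinset, Finset.mem_biUnion, Finset.mem_image, Finset.mem_range, ih,
      mem_pieces_succ]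
    refine exists_congr fun t => and_congr_right fun _ => exists_congr fun i =>
      and_congr_right fun _ => eq_comm

/-- No piece is produced twice: a coincidence would give two open hulls a common point. -/
theorem card_pieceFinset (n : ℕ) : (pieceFinset ξ n).card = totalPieces ξ n := by
  classical
  obtain ⟨z, hz⟩ := openHull_nonempty
  induction n with
  | zero => simp [pieceFinset, totalPieces]
  | succ n ih =>
    rw [pieceFinset, totalPieces, Finset.prod_range_succ, ← totalPieces, ← ih,
      Finset.card_biUnion]
    · rw [Finset.sum_const_nat]
      intro t ht
      rw [mem_pieceFinset] at ht
      rw [Finset.card_image_of_injOn, Finset.card_range]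
      intro i _ i' _ h
      have h' := similarity_childPiece (ξ n) t i z
      rw [h, similarity_childPiece] at h'
      exact (child_openHull_disjoint hz hz (similarity_injective (ne_of_mem_pieces ht) h')).symm
    · intro t ht t' ht' hne
      rw [Finset.mem_coe, mem_pieceFinset] at ht ht'
      rw [Function.onFun, Finset.disjoint_left]
      intro s hs hs'
      obtain ⟨i, hi, rfl⟩ := Finset.mem_image.1 hs
      obtain ⟨i', hi', h⟩ := Finset.mem_image.1 hs'
      refine hne ?_
      have h' := similarity_childPiece (ξ n) t i z
      rw [← h, similarity_childPiece] at h'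
      exact (eq_of_similarity_eq ht' ht (child_mem_openHull (Finset.mem_range.1 hi') hz)
        (child_mem_openHull (Finset.mem_range.1 hi) hz) h').symm

/-! ### The Koch curve as an intersection -/

variable (ξ)

/-- The union of the hulls of the pieces at iteration `n`. -/
def cover (n : ℕ) : Set ℂ := ⋃ s ∈ pieces ξ n, place s hull

variable {ξ}

theorem isCompact_hull : IsCompact hull := by
  refine Metric.isCompact_of_isClosed_isBounded isClosed_hull ?_
  exact (Metric.isBounded_closedBall (x := 0) (r := 1)).subset
    fun z hz => by simpa using norm_le_one_of_mem_hull hz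

theorem finite_pieces (n : ℕ) : (pieces ξ n).Finite :=
  (pieceFinset ξ n).finite_toSet.subset fun _ hs => mem_pieceFinset.2 hs

theorem isCompact_cover (n : ℕ) : IsCompact (cover ξ n) :=
  (finite_pieces n).isCompact_biUnion fun _ _ => isCompact_hull.image (continuous_similarity _ _)

theorem cover_antitone : Antitone (cover ξ) := by
  refine antitone_nat_of_succ_le fun n => ?_
  refine Set.iUnion₂_subset fun s hs => ?_
  obtain ⟨t, ht, i, hi, rfl⟩ := hs
  rw [← childPiece, place_childPiece]
  rintro _ ⟨_, ⟨z, hz, rfl⟩, rfl⟩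
  exact Set.mem_biUnion ht ⟨_, child_mem_hull hi hz, rfl⟩

theorem polygon_eq (n : ℕ) : polygon ξ n = ⋃ s ∈ pieces ξ n, place s unitSegment := by
  simp only [polygon, segment_eq_image_similarity, place]

theorem polygon_subset_cover (n : ℕ) : polygon ξ n ⊆ cover ξ n := by
  rw [polygon_eq]
  exact Set.iUnion₂_mono fun s _ => place_mono s unitSegment_subset_hull

theorem pieces_nonempty (n : ℕ) : ∃ s, s ∈ pieces ξ n ∧ s.1 = 0 := by
  induction n with
  | zero => exact ⟨(0, 1), rfl, rfl⟩
  | succ n ih =>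
    obtain ⟨s, hs, h0⟩ := ih
    refine ⟨childPiece (ξ n) s 0, ⟨s, hs, 0, by simp [numPieces], rfl⟩, ?_⟩
    rw [childPiece, blockVertex_zero, similarity_zero, h0]

theorem first_mem_polygon {n : ℕ} {s : ℂ × ℂ} (hs : s ∈ pieces ξ n) : s.1 ∈ polygon ξ n := by
  rw [polygon_eq]
  exact Set.mem_biUnion hs ⟨0, zero_mem_unitSegment, similarity_zero _ _⟩

theorem dist_le_of_mem_place_hull {s : ℂ × ℂ} {w : ℂ} (h : w ∈ place s hull) :
    dist w s.1 ≤ ‖s.2 - s.1‖ := by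
  obtain ⟨z, hz, rfl⟩ := h
  have := dist_similarity s.1 s.2 z 0
  rw [similarity_zero] at this
  rw [this, dist_zero_right]
  exact mul_le_of_le_one_right (norm_nonneg _) (norm_le_one_of_mem_hull hz)

theorem three_pow_le_totalScale (hξ : ∀ n, 1 ≤ ξ n) (n : ℕ) : 3 ^ n ≤ totalScale ξ n := by
  rw [totalScale, ← Finset.card_range n, ← Finset.prod_const, Finset.card_range]
  refine Finset.prod_le_prod (by simp) fun i _ => ?_
  have : (1 : ℝ) ≤ ξ i := by exact_mod_cast hξ i
  rw [cast_scale]; linarith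

theorem tendsto_inv_totalScale (hξ : ∀ n, 1 ≤ ξ n) :
    Tendsto (fun n => (totalScale ξ n)⁻¹) atTop (𝓝 0) :=
  (tendsto_atTop_mono (three_pow_le_totalScale hξ)
    (tendsto_pow_atTop_atTop_of_one_lt (by norm_num))).inv_tendsto_atTop

/-- Each cover is compact and contains all later polygons, hence their limits. Conversely a point of
the n-th cover is within the length of a piece of a vertex of the n-th polygon. -/
theorem kochCurve_eq (hξ : ∀ n, 1 ≤ ξ n) : kochCurve ξ = ⋂ n, cover ξ n := by
  ext z
  rw [Set.mem_iInter]
  constructor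
  · intro hz n
    have hne : (cover ξ n).Nonempty := by
      obtain ⟨s, hs, -⟩ := pieces_nonempty (ξ := ξ) n
      exact ⟨_, polygon_subset_cover n (first_mem_polygon hs)⟩
    rw [(isCompact_cover n).isClosed.mem_iff_infDist_zero hne]
    refine le_antisymm (ge_of_tendsto hz ?_) Metric.infDist_nonneg
    filter_upwards [eventually_ge_atTop n] with m hm
    obtain ⟨s, hs, -⟩ := pieces_nonempty (ξ := ξ) m
    exact Metric.infDist_le_infDist_of_subset
      ((polygon_subset_cover m).trans (cover_antitone hm)) ⟨_, first_mem_polygon hs⟩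
  · intro hz
    refine squeeze_zero (fun _ => Metric.infDist_nonneg) (fun n => ?_) (tendsto_inv_totalScale hξ)
    obtain ⟨s, hs, h⟩ := Set.mem_iUnion₂.1 (hz n)
    exact (Metric.infDist_le_dist_of_mem (first_mem_polygon hs)).trans
      ((dist_le_of_mem_place_hull h).trans_eq (norm_of_mem_pieces hs))

/-- The end points of the pieces lie on the Koch curve. -/
theorem first_mem_kochCurve (hξ : ∀ n, 1 ≤ ξ n) {n : ℕ} {s : ℂ × ℂ} (hs : s ∈ pieces ξ n) :
    s.1 ∈ kochCurve ξ := by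
  -- The 0-th child of a piece starts at the same point, since `blockVertex a 0 = 0`; so vertices
  -- persist at all later iterations.
  have key : ∀ k, ∃ s' ∈ pieces ξ (n + k), s'.1 = s.1 := by
    intro k
    induction k with
    | zero => exact ⟨s, hs, rfl⟩
    | succ k ih =>
      obtain ⟨t, ht, h⟩ := ih
      refine ⟨childPiece (ξ (n + k)) t 0, ⟨t, ht, 0, by simp [numPieces], rfl⟩, ?_⟩
      rw [childPiece, blockVertex_zero, similarity_zero, h]
  rw [kochCurve_eq hξ, Set.mem_iInter]
  intro m
  obtain ⟨s', hs', h⟩ := key m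
  rw [← h]
  exact cover_antitone (Nat.le_add_left m n) (polygon_subset_cover _ (first_mem_polygon hs'))

/-! ### The closed curve -/

/-- The sides of the base triangle. -/
def baseSide : Fin 3 → ℂ × ℂ := ![(0, 1), (1, thirdVertex), (thirdVertex, 0)]

theorem norm_thirdVertex : ‖thirdVertex‖ = 1 := by
  rw [← sq_eq_sq₀ (norm_nonneg _) zero_le_one, Complex.sq_norm, Complex.normSq_apply]
  have := sqrt_three_sq
  simp only [thirdVertex]; linarith

theorem norm_baseSide (k : Fin 3) : ‖(baseSide k).2 - (baseSide k).1‖ = 1 := by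
  fin_cases k
  · simp [baseSide]
  · simp only [baseSide]
    change ‖thirdVertex - 1‖ = 1
    rw [← sq_eq_sq₀ (norm_nonneg _) zero_le_one, Complex.sq_norm, Complex.normSq_apply]
    have := sqrt_three_sq
    simp only [thirdVertex, Complex.sub_re, Complex.sub_im, Complex.one_re, Complex.one_im]
    linarith
  · simp [baseSide, norm_thirdVertex]

variable (ξ)

/-- The pieces of the closed curve at iteration `n`. -/
def closedPieces (n : ℕ) : Set (ℂ × ℂ) :=
  {s | ∃ k, ∃ t ∈ pieces ξ n, s = (similarity (baseSide k).1 (baseSide k).2 t.1,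
    similarity (baseSide k).1 (baseSide k).2 t.2)}

/-- The union of the hulls of the pieces of the closed curve at iteration `n`. -/
def closedCover (n : ℕ) : Set ℂ := ⋃ s ∈ closedPieces ξ n, place s hull

/-- The polygonal closed curve at iteration `n`. -/
def closedPolygon (n : ℕ) : Set ℂ := ⋃ s ∈ closedPieces ξ n, place s unitSegment

variable {ξ}

theorem mem_closedPieces_succ {n : ℕ} {s : ℂ × ℂ} : s ∈ closedPieces ξ (n + 1) ↔
    ∃ t ∈ closedPieces ξ n, ∃ i < numPieces (ξ n), s = childPiece (ξ n) t i := by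
  constructor
  · rintro ⟨k, _, ⟨t, ht, i, hi, rfl⟩, rfl⟩
    refine ⟨_, ⟨k, t, ht, rfl⟩, i, hi, ?_⟩
    simp only [childPiece, similarity_similarity]
  · rintro ⟨_, ⟨k, t, ht, rfl⟩, i, hi, rfl⟩
    refine ⟨k, _, ⟨t, ht, i, hi, rfl⟩, ?_⟩
    simp only [childPiece, similarity_similarity]

theorem pieces_subset_closedPieces (n : ℕ) : pieces ξ n ⊆ closedPieces ξ n := by
  intro s hs
  exact ⟨0, s, hs, by simp [baseSide, similarity_zero_one]⟩

theorem norm_of_mem_closedPieces {n : ℕ} {s : ℂ × ℂ} (hs : s ∈ closedPieces ξ n) :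
    ‖s.2 - s.1‖ = (totalScale ξ n)⁻¹ := by
  obtain ⟨k, t, ht, rfl⟩ := hs
  rw [← dist_eq_norm, dist_similarity, norm_baseSide, one_mul, dist_eq_norm,
    norm_of_mem_pieces ht]

theorem ne_of_mem_closedPieces {n : ℕ} {s : ℂ × ℂ} (hs : s ∈ closedPieces ξ n) : s.1 ≠ s.2 := by
  intro h
  have := norm_of_mem_closedPieces hs
  rw [h, sub_self, norm_zero] at this
  exact (inv_pos.2 (totalScale_pos ξ n)).ne this

theorem closedCover_eq (n : ℕ) : closedCover ξ n = ⋃ k, place (baseSide k) (cover ξ n) := by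
  ext w
  simp only [closedCover, closedPieces, cover, place, Set.mem_iUnion, Set.mem_image,
    Set.mem_ofPred_eq, exists_prop]
  constructor
  · rintro ⟨_, ⟨k, t, ht, rfl⟩, z, hz, rfl⟩
    exact ⟨k, _, ⟨t, ht, z, hz, rfl⟩, (similarity_similarity _ _ _ _ _).symm⟩
  · rintro ⟨k, _, ⟨t, ht, z, hz, rfl⟩, rfl⟩
    exact ⟨_, ⟨k, t, ht, rfl⟩, z, hz, similarity_similarity _ _ _ _ _⟩

theorem jordanCurve_eq_iUnion : jordanCurve ξ = ⋃ k, place (baseSide k) (kochCurve ξ) := by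
  ext w
  simp only [jordanCurve, Set.mem_iUnion, Fin.exists_fin_succ, place, baseSide]
  simp [similarity_zero_one, or_assoc]

theorem isCompact_closedCover (n : ℕ) : IsCompact (closedCover ξ n) := by
  rw [closedCover_eq]
  exact isCompact_iUnion fun k => (isCompact_cover n).image (continuous_similarity _ _)

theorem closedCover_antitone : Antitone (closedCover ξ) := by
  intro m n hmn
  rw [closedCover_eq, closedCover_eq]
  exact Set.iUnion_mono fun k => place_mono _ (cover_antitone hmn)

theorem jordanCurve_eq (hξ : ∀ n, 1 ≤ ξ n) : jordanCurve ξ = ⋂ n, closedCover ξ n := by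
  rw [jordanCurve_eq_iUnion, kochCurve_eq hξ]
  have hne : ∀ k, (baseSide k).1 ≠ (baseSide k).2 := by
    intro k h
    have := norm_baseSide k
    rw [h, sub_self, norm_zero] at this
    exact zero_ne_one this
  ext w
  simp only [Set.mem_iUnion, Set.mem_iInter, closedCover_eq]
  constructor
  · rintro ⟨k, hk⟩ n
    exact ⟨k, place_mono _ (Set.iInter_subset _ n) hk⟩
  · intro h
    by_contra! hk
    have : ∀ k, ∃ n, w ∉ place (baseSide k) (cover ξ n) := by
      intro k
      by_contra! hn
      refine hk k ?_
      rw [place, (similarity_injective (hne k)).injOn.image_iInter_eq]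
      exact Set.mem_iInter.2 hn
    -- The sum of the three indices is a common index past which `w` is missed by all three covers.
    choose N hN using this
    obtain ⟨k, hk'⟩ := h (∑ k, N k)
    exact hN k (place_mono _ (cover_antitone
      (Finset.single_le_sum (f := N) (fun _ _ => Nat.zero_le _) (Finset.mem_univ k))) hk')

theorem isCompact_jordanCurve (hξ : ∀ n, 1 ≤ ξ n) : IsCompact (jordanCurve ξ) := by
  rw [jordanCurve_eq hξ]
  exact (isCompact_closedCover 0).of_isClosed_subset
    (isClosed_iInter fun n => (isCompact_closedCover n).isClosed) (Set.iInter_subset _ 0)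

/-! ### The filled polygons -/

variable (ξ)

/-- The union of all the triangles up to iteration `n`. -/
def filled : ℕ → Set ℂ
  | 0 => rightTriangle
  | n + 1 => filled n ∪ ⋃ s ∈ closedPieces ξ (n + 1), place s rightTriangle

variable {ξ}

theorem finite_closedPieces (n : ℕ) : (closedPieces ξ n).Finite := by
  have : closedPieces ξ n ⊆ ⋃ k, (fun t : ℂ × ℂ => (similarity (baseSide k).1 (baseSide k).2 t.1,
      similarity (baseSide k).1 (baseSide k).2 t.2)) '' pieces ξ n := by
    rintro _ ⟨k, t, ht, rfl⟩
    exact Set.mem_iUnion.2 ⟨k, t, ht, rfl⟩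
  exact (Set.finite_iUnion fun k => (finite_pieces n).image _).subset this

theorem isCompact_rightTriangle : IsCompact rightTriangle := by
  refine Metric.isCompact_of_isClosed_isBounded isClosed_rightTriangle ?_
  exact (Metric.isBounded_closedBall (x := 0) (r := 2)).subset
    fun z hz => by simpa using norm_le_two_of_mem_rightTriangle hz

theorem isCompact_filled (n : ℕ) : IsCompact (filled ξ n) := by
  induction n with
  | zero => exact isCompact_rightTriangle
  | succ n ih =>
    exact ih.union ((finite_closedPieces (n + 1)).isCompact_biUnion
      fun _ _ => isCompact_rightTriangle.image (continuous_similarity _ _))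

theorem filled_mono : Monotone (filled ξ) :=
  monotone_nat_of_le_succ fun _ => Set.subset_union_left

theorem place_subset_filled {n : ℕ} {s : ℂ × ℂ} (hs : s ∈ closedPieces ξ n) :
    place s rightTriangle ⊆ filled ξ n := by
  cases n with
  | zero =>
    obtain ⟨k, t, rfl, rfl⟩ := hs
    rintro _ ⟨z, hz, rfl⟩
    dsimp only
    rw [similarity_similarity, similarity_zero_one]
    fin_cases k
    · change similarity 0 1 z ∈ _
      rwa [similarity_zero_one]
    · exact similarity_base_one_mem hz
    · exact similarity_base_two_mem hz
  | succ n => exact fun w hw => Or.inr (Set.mem_biUnion hs hw)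

theorem place_childTriangles_subset_filled {n : ℕ} {t : ℂ × ℂ} (ht : t ∈ closedPieces ξ n) :
    place t (childTriangles (ξ n)) ⊆ filled ξ (n + 1) := by
  rintro _ ⟨w, hw, rfl⟩
  obtain ⟨i, hi, z, hz, rfl⟩ := Set.mem_iUnion₂.1 hw
  rw [← similarity_childPiece]
  exact place_subset_filled (mem_closedPieces_succ.2 ⟨t, ht, i, hi, rfl⟩) ⟨z, hz, rfl⟩

theorem place_generator_subset_closedPolygon {n : ℕ} {t : ℂ × ℂ} (ht : t ∈ closedPieces ξ n) :
    place t (generator (ξ n)) ⊆ closedPolygon ξ (n + 1) := by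
  rintro _ ⟨w, hw, rfl⟩
  obtain ⟨i, hi, z, hz, rfl⟩ := Set.mem_iUnion₂.1 hw
  rw [← similarity_childPiece]
  exact Set.mem_biUnion (mem_closedPieces_succ.2 ⟨t, ht, i, hi, rfl⟩) ⟨z, hz, rfl⟩

/-- Passing to the next iteration, an old edge survives on its flat pieces while the bases of its
spikes become interior; a new triangle contributes to the frontier only through new edges or points
already filled. -/
theorem frontier_filled_subset (n : ℕ) : frontier (filled ξ n) ⊆ closedPolygon ξ n := by
  induction n with
  | zero =>
    refine frontier_rightTriangle_subset.trans ?_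
    have key : ∀ k, place (baseSide k) unitSegment ⊆ closedPolygon ξ 0 := by
      intro k
      refine Set.subset_biUnion_of_mem (u := fun s => place s unitSegment) ?_
      exact ⟨k, (0, 1), rfl, by simp [similarity_zero, similarity_one]⟩
    rintro z ((h | h) | h)
    · exact key 0 ⟨z, h, similarity_zero_one z⟩
    · exact key 1 h
    · exact key 2 h
  | succ n ih =>
    intro w hw
    rw [(isCompact_filled (n + 1)).isClosed.frontier_eq] at hw
    obtain ⟨hw, hw'⟩ := hw
    have old : w ∈ filled ξ n → w ∈ closedPolygon ξ (n + 1) := by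
      intro h
      have h1 : w ∈ frontier (filled ξ n) := by
        rw [(isCompact_filled n).isClosed.frontier_eq]
        exact ⟨h, fun h' => hw' (interior_mono (filled_mono n.le_succ) h')⟩
      obtain ⟨t, ht, h2⟩ := Set.mem_iUnion₂.1 (ih h1)
      have h3 := place_mono t (unitSegment_subset (ξ n)) h2
      rw [place_union] at h3
      rcases h3 with h3 | h3
      · exact place_generator_subset_closedPolygon ht h3
      · rw [place, image_interior_similarity (ne_of_mem_closedPieces ht)] at h3
        refine absurd (interior_mono ?_ h3) hw'
        rw [← place, place_union]
        exact Set.union_subset ((place_subset_filled ht).trans (filled_mono n.le_succ))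
          (place_childTriangles_subset_filled ht)
    rcases hw with hw | hw
    · exact old hw
    · obtain ⟨s, hs, hws⟩ := Set.mem_iUnion₂.1 hw
      obtain ⟨t, ht, i, hi, rfl⟩ := mem_closedPieces_succ.1 hs
      rw [place_childPiece] at hws
      have h1 : w ∈ place t (childTriangles (ξ n)) :=
        place_mono t (fun z hz => Set.mem_iUnion₂.2 ⟨i, hi, hz⟩) hws
      have h2 := place_mono t (childTriangles_subset (ξ n)) h1
      rw [place_union, place_union] at h2
      rcases h2 with (h2 | h2) | h2
      · exact old (place_subset_filled ht h2)
      · exact place_generator_subset_closedPolygon ht h2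
      · rw [place, image_interior_similarity (ne_of_mem_closedPieces ht)] at h2
        exact absurd (interior_mono (place_childTriangles_subset_filled ht) h2) hw'

/-- Everything added after iteration n stays in the hulls of iteration n, so the frontier of the
whole union is caught by every closed cover. -/
theorem filled_subset_union {m n : ℕ} (hnm : n ≤ m) :
    filled ξ m ⊆ filled ξ n ∪ closedCover ξ n := by
  induction m, hnm using Nat.le_induction with
  | base => exact Set.subset_union_left
  | succ m hnm ih =>
    refine Set.union_subset ih (Set.iUnion₂_subset fun s hs => ?_)
    obtain ⟨t, ht, i, hi, rfl⟩ := mem_closedPieces_succ.1 hs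
    rw [place_childPiece]
    have h : child (ξ m) i '' rightTriangle ⊆ rightTriangle ∪ hull := by
      rintro _ ⟨z, hz, rfl⟩
      exact rightTriangle_child_subset hi hz
    refine (place_mono t h).trans ?_
    rw [place_union]
    refine Set.union_subset ((place_subset_filled ht).trans ih) ?_
    refine Set.subset_union_of_subset_right ?_ _
    exact (Set.subset_biUnion_of_mem (u := fun s => place s hull) ht).trans
      (closedCover_antitone hnm)

theorem closedPolygon_subset_closedCover (n : ℕ) : closedPolygon ξ n ⊆ closedCover ξ n :=
  Set.iUnion₂_mono fun s _ => place_mono s unitSegment_subset_hull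

theorem frontier_iUnion_filled_subset (hξ : ∀ n, 1 ≤ ξ n) :
    frontier (⋃ n, filled ξ n) ⊆ jordanCurve ξ := by
  intro w hw
  rw [jordanCurve_eq hξ, Set.mem_iInter]
  intro n
  have hsub : ⋃ m, filled ξ m ⊆ filled ξ n ∪ closedCover ξ n := by
    refine Set.iUnion_subset fun m => ?_
    rcases le_total n m with h | h
    · exact filled_subset_union h
    · exact (filled_mono h).trans Set.subset_union_left
  have hcl := closure_minimal hsub
    ((isCompact_filled n).isClosed.union (isCompact_closedCover n).isClosed)
  rcases hcl hw.1 with h | h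
  · refine closedPolygon_subset_closedCover n (frontier_filled_subset n ?_)
    rw [(isCompact_filled n).isClosed.frontier_eq]
    exact ⟨h, fun h' => hw.2 (interior_mono (Set.subset_iUnion _ n) h')⟩
  · exact h

theorem isBounded_iUnion_filled : Bornology.IsBounded (⋃ n, filled ξ n) :=
  ((isCompact_filled 0).isBounded.union (isCompact_closedCover 0).isBounded).subset
    (Set.iUnion_subset fun m => filled_subset_union (ξ := ξ) (Nat.zero_le m))

/-- A bounded set whose frontier lies on `J` is, apart from `J`, enclosed by `J`. -/
theorem diff_subset_enclosed {U J : Set ℂ} (hU : Bornology.IsBounded U) (hJ : frontier U ⊆ J) :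
    U \ J ⊆ enclosed J := by
  rintro z ⟨hzU, hzJ⟩
  refine ⟨hzJ, hU.subset ?_⟩
  have hC := connectedComponentIn_subset Jᶜ z
  -- A connected set off the frontier is covered by the disjoint open sets `interior U` and
  -- `(closure U)ᶜ`; it meets the first at `z`, so it stays there.
  refine (IsPreconnected.subset_left_of_subset_union isOpen_interior
    (isClosed_closure (s := U)).isOpen_compl ?_ ?_ ⟨z, mem_connectedComponentIn hzJ, ?_⟩ isPreconnected_connectedComponentIn).trans
      interior_subset
  · exact Set.disjoint_compl_right_iff_subset.2 (interior_subset.trans subset_closure)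
  · intro w hw
    by_contra h
    rw [Set.mem_union, not_or, Set.notMem_compl_iff] at h
    exact hC hw (hJ ⟨h.2, h.1⟩)
  · by_contra h
    exact hzJ (hJ ⟨subset_closure hzU, h⟩)

/-- Membership in `enclosed J` is constant on each component of the complement, and these components
are open. -/
theorem frontier_enclosed_subset {J : Set ℂ} (hJ : IsClosed J) : frontier (enclosed J) ⊆ J := by
  intro z hz
  by_contra hzJ
  have hopen : IsOpen (connectedComponentIn Jᶜ z) := hJ.isOpen_compl.connectedComponentIn
  have hmem : z ∈ connectedComponentIn Jᶜ z := mem_connectedComponentIn hzJ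
  have key : ∀ w ∈ connectedComponentIn Jᶜ z, w ∈ enclosed J ↔ z ∈ enclosed J := by
    intro w hw
    rw [enclosed, Set.mem_ofPred_eq, Set.mem_ofPred_eq, connectedComponentIn_eq hw]
    exact and_congr_left fun _ => ⟨fun _ => hzJ, fun _ => connectedComponentIn_subset _ _ hw⟩
  by_cases h : z ∈ enclosed J
  · exact hz.2 (mem_interior.2 ⟨_, fun w hw => (key w hw).2 h, hopen, hmem⟩)
  · obtain ⟨w, hw, hw'⟩ := mem_closure_iff.1 hz.1 _ hopen hmem
    exact h ((key w hw).1 hw')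

end Snowflake

namespace Snowflake

/-! ### The inner tubular volume -/

variable {ξ : ℕ → ℕ}

theorem jordanCurve_subset_closedBalls (hξ : ∀ n, 1 ≤ ξ n) (n : ℕ) :
    jordanCurve ξ ⊆ ⋃ k, ⋃ s ∈ pieceFinset ξ n,
      Metric.closedBall (similarity (baseSide k).1 (baseSide k).2 s.1) (totalScale ξ n)⁻¹ := by
  intro w hw
  rw [jordanCurve_eq hξ] at hw
  obtain ⟨_, ⟨k, t, ht, rfl⟩, h⟩ := Set.mem_iUnion₂.1 (Set.mem_iInter.1 hw n)
  refine Set.mem_iUnion.2 ⟨k, Set.mem_iUnion₂.2 ⟨t, mem_pieceFinset.2 ht, ?_⟩⟩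
  exact (dist_le_of_mem_place_hull h).trans_eq (norm_of_mem_closedPieces ⟨k, t, ht, rfl⟩)

theorem natCast_mul_area (N : ℕ) {r : ℝ} (hr : 0 ≤ r) :
    (N : ENNReal) * (ENNReal.ofReal r ^ 2 * NNReal.pi) = ENNReal.ofReal (Real.pi * N * r ^ 2) := by
  rw [ENNReal.ofReal_mul (by positivity), ENNReal.ofReal_mul (by positivity),
    ENNReal.ofReal_natCast, ENNReal.ofReal_pow hr, ← NNReal.coe_real_pi, ENNReal.ofReal_coe_nnreal]
  ring

theorem volume_cthickening_jordanCurve_le (hξ : ∀ n, 1 ≤ ξ n) (n : ℕ) {ε : ℝ} (hε : 0 ≤ ε) :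
    (volume : Measure ℂ) (Metric.cthickening ε (jordanCurve ξ)) ≤
      ENNReal.ofReal (3 * Real.pi * totalPieces ξ n * ((totalScale ξ n)⁻¹ + ε) ^ 2) := by
  have hL := totalScale_pos ξ n
  have hsub : Metric.cthickening ε (jordanCurve ξ) ⊆ ⋃ k, ⋃ s ∈ pieceFinset ξ n,
      Metric.closedBall (similarity (baseSide k).1 (baseSide k).2 s.1)
        ((totalScale ξ n)⁻¹ + ε) := by
    rw [(isCompact_jordanCurve hξ).cthickening_eq_biUnion_closedBall hε]
    refine Set.iUnion₂_subset fun y hy w hw => ?_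
    obtain ⟨k, hk⟩ := Set.mem_iUnion.1 (jordanCurve_subset_closedBalls hξ n hy)
    obtain ⟨s, hs, hys⟩ := Set.mem_iUnion₂.1 hk
    refine Set.mem_iUnion.2 ⟨k, Set.mem_iUnion₂.2 ⟨s, hs, ?_⟩⟩
    rw [Metric.mem_closedBall] at *
    linarith [dist_triangle w y (similarity (baseSide k).1 (baseSide k).2 s.1)]
  refine (measure_mono hsub).trans ((measure_iUnion_fintype_le _ _).trans ?_)
  have h1 : ∀ k, (volume : Measure ℂ) (⋃ s ∈ pieceFinset ξ n,
      Metric.closedBall (similarity (baseSide k).1 (baseSide k).2 s.1)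
        ((totalScale ξ n)⁻¹ + ε)) ≤
      ENNReal.ofReal (Real.pi * totalPieces ξ n * ((totalScale ξ n)⁻¹ + ε) ^ 2) := by
    intro k
    refine (measure_biUnion_finset_le _ _).trans ?_
    simp only [Complex.volume_closedBall, Finset.sum_const, card_pieceFinset, nsmul_eq_mul]
    exact (natCast_mul_area _ (by positivity)).le
  refine (Finset.sum_le_sum fun k _ => h1 k).trans ?_
  rw [Finset.sum_const, Finset.card_univ, Fintype.card_fin, nsmul_eq_mul,
    mul_assoc 3 Real.pi, mul_assoc 3, ENNReal.ofReal_mul (by norm_num : (0 : ℝ) ≤ 3)]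
  simp

theorem totalPieces_pos (n : ℕ) : 0 < totalPieces ξ n :=
  Finset.prod_pos fun _ _ => Nat.succ_pos _

/-- Each factor (3a+1)/(2a+1)² is at most 4/9, its value at a = 1; the difference has the sign of
(a−1)(16a+5). -/
theorem totalPieces_le (hξ : ∀ n, 1 ≤ ξ n) (n : ℕ) :
    (totalPieces ξ n : ℝ) * (totalScale ξ n)⁻¹ ^ 2 ≤ (4 / 9) ^ n := by
  have hL := totalScale_pos ξ n
  rw [inv_pow, ← div_eq_mul_inv, totalPieces, totalScale, ← Finset.prod_pow, Nat.cast_prod,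
    ← Finset.prod_div_distrib]
  rw [← Finset.card_range n, ← Finset.prod_const, Finset.card_range]
  refine Finset.prod_le_prod (fun i _ => by positivity) fun i _ => ?_
  have : (1 : ℝ) ≤ ξ i := by exact_mod_cast hξ i
  rw [cast_scale, div_le_div_iff₀ (by positivity) (by norm_num), numPieces]
  push_cast
  nlinarith

/-- Allows the curve to be removed from the discs in `le_innerVolume` at no cost of area. -/
theorem volume_jordanCurve (hξ : ∀ n, 1 ≤ ξ n) : (volume : Measure ℂ) (jordanCurve ξ) = 0 := by
  have h0 : Tendsto (fun n : ℕ => ENNReal.ofReal (3 * Real.pi * (4 / 9) ^ n)) atTop (𝓝 0) := by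
    rw [← ENNReal.ofReal_zero]
    refine ENNReal.tendsto_ofReal ?_
    have := (tendsto_pow_atTop_nhds_zero_of_lt_one (r := (4 / 9 : ℝ)) (by norm_num)
      (by norm_num)).const_mul (3 * Real.pi)
    rwa [mul_zero] at this
  refine le_antisymm (ge_of_tendsto' h0 fun n => ?_) (zero_le)
  refine (measure_mono (Metric.self_subset_cthickening _ (δ := 0))).trans
    ((volume_cthickening_jordanCurve_le hξ n le_rfl).trans (ENNReal.ofReal_le_ofReal ?_))
  rw [add_zero, mul_assoc]
  have := totalPieces_le hξ n
  gcongr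

theorem frontier_snowflake_subset (hξ : ∀ n, 1 ≤ ξ n) :
    frontier (snowflake ξ) ⊆ jordanCurve ξ :=
  frontier_enclosed_subset (isCompact_jordanCurve hξ).isClosed

theorem innerVolume_le (hξ : ∀ n, 1 ≤ ξ n) (n : ℕ) {ε : ℝ} (hε : 0 ≤ ε) :
    innerVolume (snowflake ξ) ε ≤
      3 * Real.pi * totalPieces ξ n * ((totalScale ξ n)⁻¹ + ε) ^ 2 := by
  refine ENNReal.toReal_le_of_le_ofReal (by positivity) ?_
  refine le_trans (measure_mono ?_) (volume_cthickening_jordanCurve_le hξ n hε)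
  exact Set.inter_subset_left.trans
    (Metric.cthickening_subset_of_subset _ (frontier_snowflake_subset hξ))

theorem pieces_first_notMem_snowflake (hξ : ∀ n, 1 ≤ ξ n) {n : ℕ} {s : ℂ × ℂ}
    (hs : s ∈ pieces ξ n) : s.1 ∉ snowflake ξ := by
  intro h
  refine h.1 ?_
  rw [jordanCurve]
  exact Or.inl (Or.inl (first_mem_kochCurve hξ hs))

/-- A nearby point outside `D` is enough, as a frontier point is then at least as near. Thus it need
not be known that the whole curve is the frontier of `D`. -/
theorem mem_cthickening_frontier {D : Set ℂ} {z p : ℂ} {ε : ℝ} (hz : z ∈ D) (hp : p ∉ D)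
    (h : dist z p ≤ ε) : z ∈ Metric.cthickening ε (frontier D) := by
  obtain ⟨y, hy, hzy⟩ := exists_mem_frontier_infDist_compl_eq_dist hz
    (fun h : D = Set.univ => hp (h ▸ Set.mem_univ p))
  refine Metric.mem_cthickening_of_dist_le z y _ _ hy ?_
  rw [← hzy]
  exact (Metric.infDist_le_dist_of_mem hp).trans h

theorem ball_similarity_subset (p q c : ℂ) (h : p ≠ q) (r : ℝ) :
    Metric.ball (similarity p q c) (‖q - p‖ * r) ⊆ similarity p q '' Metric.ball c r := by
  intro w hw
  obtain ⟨z, rfl⟩ := (similarityHomeomorph h).surjective w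
  refine ⟨z, ?_, rfl⟩
  change dist (similarity p q z) _ < _ at hw
  rw [dist_similarity] at hw
  exact lt_of_mul_lt_mul_left hw (norm_nonneg _)

/-- One disc in the first spike to be built on each piece of the side [0, 1]. The initial point of
the piece lies on the curve, hence outside the open region, and is within the length of the piece.
-/
theorem le_innerVolume (hξ : ∀ n, 1 ≤ ξ n) (n : ℕ) {ε : ℝ} (hε : (totalScale ξ n)⁻¹ ≤ ε) :
    Real.pi * totalPieces ξ n * ((totalScale ξ n)⁻¹ * (1 / (8 * scale (ξ n)))) ^ 2 ≤
      innerVolume (snowflake ξ) ε := by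
  have hL := totalScale_pos ξ n
  have hl := scale_pos (ξ n)
  set r : ℝ := 1 / (8 * scale (ξ n)) with hr
  let b : ℂ × ℂ → Set ℂ := fun s =>
    Metric.ball (similarity s.1 s.2 (spikeCenter (ξ n))) ((totalScale ξ n)⁻¹ * r)
  have hb : ∀ s ∈ pieces ξ n, b s ⊆ place s (openHull ∩ spike (ξ n) 0) := by
    intro s hs
    refine Set.Subset.trans ?_ (place_mono s (ball_spikeCenter_subset (hξ n)))
    have := ball_similarity_subset s.1 s.2 (spikeCenter (ξ n)) (ne_of_mem_pieces hs) r
    rwa [norm_of_mem_pieces hs] at this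
  have hvol : (volume : Measure ℂ) (⋃ s ∈ pieceFinset ξ n, b s) =
      ENNReal.ofReal (Real.pi * totalPieces ξ n * ((totalScale ξ n)⁻¹ * r) ^ 2) := by
    rw [measure_biUnion_finset]
    · simp only [b, Complex.volume_ball, Finset.sum_const, card_pieceFinset, nsmul_eq_mul]
      exact natCast_mul_area _ (by positivity)
    · intro s hs s' hs' hne
      rw [Finset.mem_coe, mem_pieceFinset] at hs hs'
      rw [Function.onFun, Set.disjoint_left]
      intro w hw hw'
      obtain ⟨z, hz, rfl⟩ := hb s hs hw
      obtain ⟨z', hz', h⟩ := hb s' hs' hw'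
      exact hne (eq_of_similarity_eq hs hs' hz.1 hz'.1 h.symm)
    · exact fun s _ => measurableSet_ball
  have hsub : (⋃ s ∈ pieceFinset ξ n, b s) \ jordanCurve ξ ⊆
      Metric.cthickening ε (frontier (snowflake ξ)) ∩ snowflake ξ := by
    rintro w ⟨hw, hwJ⟩
    obtain ⟨s, hs, hws⟩ := Set.mem_iUnion₂.1 hw
    rw [mem_pieceFinset] at hs
    obtain ⟨z, hz, rfl⟩ := hb s hs hws
    have hD : similarity s.1 s.2 z ∈ snowflake ξ := by
      refine diff_subset_enclosed isBounded_iUnion_filled (frontier_iUnion_filled_subset hξ)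
        ⟨Set.mem_iUnion.2 ⟨n + 1, ?_⟩, hwJ⟩
      refine place_childTriangles_subset_filled (pieces_subset_closedPieces n hs) ⟨z, ?_, rfl⟩
      exact spike_subset_childTriangles (hξ n) hz.2
    refine ⟨mem_cthickening_frontier hD (pieces_first_notMem_snowflake hξ hs) ?_, hD⟩
    refine (dist_le_of_mem_place_hull ⟨z, openHull_subset_hull hz.1, rfl⟩).trans ?_
    rwa [norm_of_mem_pieces hs]
  have hfin : (volume : Measure ℂ)
      (Metric.cthickening ε (frontier (snowflake ξ)) ∩ snowflake ξ) ≠ ⊤ := by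
    refine (lt_of_le_of_lt (measure_mono Set.inter_subset_left)
      (Bornology.IsBounded.measure_lt_top ?_)).ne
    exact ((isCompact_jordanCurve hξ).isBounded.subset (frontier_snowflake_subset hξ)).cthickening
  rw [innerVolume, Measure.real, ← ENNReal.ofReal_le_iff_le_toReal hfin, ← hvol,
    ← measure_sdiff_null (volume_jordanCurve hξ)]
  exact measure_mono hsub

end Snowflake

namespace Snowflake

/-! ### Sums of independent random variables: upper bound in the law of the iterated logarithm -/

open scoped NNReal in
/-- The exponential of a random walk with centred increments is a submartingale. -/
theorem submartingale_exp_sum {Ω : Type*} [MeasurableSpace Ω] {P : Measure Ω}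
    [IsProbabilityMeasure P] {X : ℕ → Ω → ℝ} {c : ℝ≥0} (hX : ∀ n, StronglyMeasurable (X n))
    (hindep : iIndepFun X P) (hsub : ∀ n, HasSubgaussianMGF (X n) c P)
    (hmean : ∀ n, ∫ ω, X n ω ∂P = 0) (t : ℝ) :
    Submartingale (fun n ω => Real.exp (t * ∑ i ∈ Finset.range (n + 1), X i ω))
      (Filtration.natural X hX) P := by
  have hint : ∀ n, Integrable (fun ω => Real.exp (t * ∑ i ∈ Finset.range (n + 1), X i ω)) P :=
    fun n => (HasSubgaussianMGF.sum_of_iIndepFun hindep fun i _ => hsub i).integrable_exp_mul t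
  have hadp : StronglyAdapted (Filtration.natural X hX)
      (fun n ω => Real.exp (t * ∑ i ∈ Finset.range (n + 1), X i ω)) := by
    intro n
    refine Real.continuous_exp.comp_stronglyMeasurable (StronglyMeasurable.const_mul ?_ t)
    refine Finset.stronglyMeasurable_fun_sum _ fun i hi => ?_
    exact (Filtration.stronglyAdapted_natural hX i).mono
      ((Filtration.natural X hX).mono (Nat.lt_succ_iff.1 (Finset.mem_range.1 hi)))
  refine submartingale_nat hadp hint fun n => ?_
  set f : Ω → ℝ := fun ω => Real.exp (t * ∑ i ∈ Finset.range (n + 1), X i ω) with hf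
  set g : Ω → ℝ := fun ω => Real.exp (t * X (n + 1) ω) with hg
  have hfg : (fun ω => Real.exp (t * ∑ i ∈ Finset.range (n + 1 + 1), X i ω)) = f * g := by
    ext ω
    simp only [hf, hg, Pi.mul_apply]
    rw [← Real.exp_add, ← mul_add, Finset.sum_range_succ]
  have hgint : Integrable g P := (hsub (n + 1)).integrable_exp_mul t
  have h1 : P[f * g | Filtration.natural X hX n] =ᵐ[P] f * P[g | Filtration.natural X hX n] :=
    condExp_mul_of_stronglyMeasurable_left (hadp n) (hfg ▸ hint (n + 1)) hgint
  have h2 : P[g | Filtration.natural X hX n] =ᵐ[P] fun _ => ∫ ω, g ω ∂P := by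
    refine condExp_indep_eq (hX (n + 1)).measurable.comap_le ((Filtration.natural X hX).le n) ?_
      (hindep.indep_comap_natural_of_lt hX n.lt_succ_self)
    exact Real.continuous_exp.comp_stronglyMeasurable
      (StronglyMeasurable.const_mul (comap_measurable (X (n + 1))).stronglyMeasurable t)
  -- From e^x ≥ 1 + x and the vanishing mean.
  have h3 : 1 ≤ ∫ ω, g ω ∂P := by
    have hXint : Integrable (X (n + 1)) P := (hsub (n + 1)).integrable
    have : ∫ ω, (1 + t * X (n + 1) ω) ∂P = 1 := by
      rw [integral_add (integrable_const _) (hXint.const_mul t), integral_const_mul, hmean]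
      simp
    rw [← this]
    refine integral_mono ((integrable_const _).add (hXint.const_mul t)) hgint fun ω => ?_
    simp only [hg]
    linarith [Real.add_one_le_exp (t * X (n + 1) ω)]
  rw [hfg]
  filter_upwards [h1, h2] with ω hω1 hω2
  rw [hω1, Pi.mul_apply, hω2]
  exact le_mul_of_one_le_right (Real.exp_pos _).le h3

open scoped NNReal in
/-- A maximal version of the Hoeffding inequality. -/
theorem measure_exists_sum_ge_le {Ω : Type*} [MeasurableSpace Ω] {P : Measure Ω}
    [IsProbabilityMeasure P] {X : ℕ → Ω → ℝ} {c : ℝ≥0} (hX : ∀ n, StronglyMeasurable (X n))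
    (hindep : iIndepFun X P) (hsub : ∀ n, HasSubgaussianMGF (X n) c P)
    (hmean : ∀ n, ∫ ω, X n ω ∂P = 0) (hc : 0 < c) {N : ℕ} (hN : 0 < N) {x : ℝ} (hx : 0 < x) :
    P {ω | ∃ k ≤ N, x ≤ ∑ i ∈ Finset.range k, X i ω} ≤
      ENNReal.ofReal (Real.exp (-x ^ 2 / (2 * N * c))) := by
  -- The submartingale at time n is built on n + 1 summands; the empty sum is excluded below by `0 <
  -- x`.
  obtain ⟨n, rfl⟩ : ∃ n, N = n + 1 := ⟨N - 1, by omega⟩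
  have hc' : (0 : ℝ) < c := hc
  have hN' : (0 : ℝ) < ((n + 1 : ℕ) : ℝ) := by positivity
  -- The minimiser of the exponent −t x + N c t² / 2.
  set t : ℝ := x / (((n + 1 : ℕ) : ℝ) * c) with ht
  have ht0 : 0 < t := by positivity
  have hmart := submartingale_exp_sum hX hindep hsub hmean t
  have hmax := maximal_ineq hmart (fun n ω => (Real.exp_pos _).le)
    (ε := ⟨Real.exp (t * x), (Real.exp_pos _).le⟩) n
  have hsubset : {ω | ∃ k ≤ n + 1, x ≤ ∑ i ∈ Finset.range k, X i ω} ⊆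
      {ω | (((⟨Real.exp (t * x), (Real.exp_pos _).le⟩ : ℝ≥0)) : ℝ) ≤
        (Finset.range (n + 1)).sup' Finset.nonempty_range_add_one
          fun k => Real.exp (t * ∑ i ∈ Finset.range (k + 1), X i ω)} := by
    rintro ω ⟨k, hk, hxk⟩
    obtain ⟨j, rfl⟩ : ∃ j, k = j + 1 := by
      rcases k with _ | j
      · simp only [Finset.range_zero, Finset.sum_empty] at hxk; linarith
      · exact ⟨j, rfl⟩
    have hj : j ∈ Finset.range (n + 1) := Finset.mem_range.2 (by omega)
    refine le_trans ?_ (Finset.le_sup'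
      (fun k => Real.exp (t * ∑ i ∈ Finset.range (k + 1), X i ω)) hj)
    exact Real.exp_le_exp.2 (by gcongr)
  have hS := HasSubgaussianMGF.sum_of_iIndepFun hindep (s := Finset.range (n + 1))
    fun i _ => hsub i
  have hle : ∫ ω in {ω | (((⟨Real.exp (t * x), (Real.exp_pos _).le⟩ : ℝ≥0)) : ℝ) ≤
        (Finset.range (n + 1)).sup' Finset.nonempty_range_add_one
          fun k => Real.exp (t * ∑ i ∈ Finset.range (k + 1), X i ω)},
        Real.exp (t * ∑ i ∈ Finset.range (n + 1), X i ω) ∂P ≤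
      Real.exp (((n + 1 : ℕ) : ℝ) * c * t ^ 2 / 2) := by
    refine (setIntegral_le_integral (hS.integrable_exp_mul t)
      (ae_of_all _ fun ω => (Real.exp_pos _).le)).trans ?_
    have := hS.mgf_le t
    simpa [mgf] using this
  have hfin := (mul_le_mul_right (measure_mono hsubset) _).trans
    (hmax.trans (ENNReal.ofReal_le_ofReal hle))
  have hcoe : ENNReal.ofNNReal ⟨Real.exp (t * x), (Real.exp_pos _).le⟩ =
      ENNReal.ofReal (Real.exp (t * x)) := (ENNReal.ofReal_eq_coe_nnreal _).symm
  rw [hcoe, mul_comm, ← ENNReal.le_div_iff_mul_le (Or.inl (by simp [Real.exp_pos]))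
    (Or.inl ENNReal.ofReal_ne_top), ← ENNReal.ofReal_div_of_pos (Real.exp_pos _),
    ← Real.exp_sub] at hfin
  refine hfin.trans (le_of_eq ?_)
  congr 2
  rw [ht]; field_simp; ring

/-- Crudely, k + 1 ≤ (log n)². -/
theorem log_le_two_mul_log_log {n k : ℕ} (h : 2 ^ k ≤ n) (hn : 3 ≤ Real.log n) :
    Real.log (k + 1) ≤ 2 * Real.log (Real.log n) := by
  have h1 : (k : ℝ) * Real.log 2 ≤ Real.log n := by
    rw [← Real.log_pow]
    exact Real.log_le_log (by positivity) (by exact_mod_cast h)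
  have h2 := Real.log_two_gt_d9
  have hk : (0 : ℝ) ≤ k := by positivity
  have h3 : (k : ℝ) + 1 ≤ Real.log n ^ 2 := by nlinarith
  have := Real.log_le_log (by positivity) h3
  rwa [Real.log_pow] at this

theorem eventually_le_log (C : ℝ) : ∀ᶠ n : ℕ in atTop, C ≤ Real.log n :=
  (Real.tendsto_log_atTop.comp tendsto_natCast_atTop_atTop).eventually_ge_atTop C

open scoped NNReal in
/-- The upper half of the law of the iterated logarithm, with a constant that is not sharp. -/
theorem ae_eventually_sum_le {Ω : Type*} [MeasurableSpace Ω] {P : Measure Ω}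
    [IsProbabilityMeasure P] {X : ℕ → Ω → ℝ} {c : ℝ≥0} (hX : ∀ n, StronglyMeasurable (X n))
    (hindep : iIndepFun X P) (hsub : ∀ n, HasSubgaussianMGF (X n) c P)
    (hmean : ∀ n, ∫ ω, X n ω ∂P = 0) (hc : 0 < c) :
    ∀ᵐ ω ∂P, ∀ᶠ n : ℕ in atTop, ∑ i ∈ Finset.range n, X i ω ≤
      4 * √c * √(n * Real.log (Real.log n)) := by
  have hc' : (0 : ℝ) < c := hc
  -- Chosen so that the maximal inequality up to time 2^(k+1) gives the summable probability
  -- (k+1)⁻².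
  let x : ℕ → ℝ := fun k => √(8 * c * 2 ^ k * Real.log (k + 1))
  have hlog : ∀ k : ℕ, 0 ≤ Real.log ((k : ℝ) + 1) := fun k =>
    Real.log_nonneg (by linarith [Nat.cast_nonneg (α := ℝ) k])
  have hx0 : ∀ k ≥ 1, 0 < x k := by
    intro k hk
    have : (1 : ℝ) ≤ k := by exact_mod_cast hk
    have := Real.log_pos (show (1 : ℝ) < k + 1 by linarith)
    exact Real.sqrt_pos.2 (by positivity)
  -- The clause `1 ≤ k` discards k = 0, where `x 0 = 0` and the maximal inequality does not apply.
  have hb : ∀ k, P {ω | 1 ≤ k ∧ ∃ j ≤ 2 ^ (k + 1), x k ≤ ∑ i ∈ Finset.range j, X i ω} ≤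
      ENNReal.ofReal (1 / (k + 1 : ℝ) ^ 2) := by
    intro k
    rcases Nat.eq_zero_or_pos k with rfl | hk
    · simp
    refine (measure_mono fun ω hω => hω.2).trans
      ((measure_exists_sum_ge_le hX hindep hsub hmean hc (by positivity) (hx0 k hk)).trans ?_)
    refine ENNReal.ofReal_le_ofReal (le_of_eq ?_)
    have h1 : -x k ^ 2 / (2 * ((2 ^ (k + 1) : ℕ) : ℝ) * c) = -(2 * Real.log (k + 1)) := by
      have := hlog k
      simp only [x]
      rw [Real.sq_sqrt (by positivity)]
      push_cast
      field_simp
      ring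
    rw [h1, Real.exp_neg, two_mul, Real.exp_add, Real.exp_log (by positivity), one_div, sq]
  have hsum : (∑' k, P {ω | 1 ≤ k ∧ ∃ j ≤ 2 ^ (k + 1), x k ≤ ∑ i ∈ Finset.range j, X i ω}) ≠ ⊤ := by
    refine ne_top_of_le_ne_top ?_ (ENNReal.tsum_le_tsum hb)
    have : Summable fun k : ℕ => 1 / ((k : ℝ) + 1) ^ 2 := by
      have := (summable_nat_add_iff 1).2 (Real.summable_one_div_nat_pow.2 one_lt_two)
      exact_mod_cast this
    rw [← ENNReal.ofReal_tsum_of_nonneg (fun k => by positivity) this]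
    exact ENNReal.ofReal_ne_top
  filter_upwards [ae_eventually_notMem hsum] with ω hω
  obtain ⟨k₀, hk₀⟩ := eventually_atTop.1 hω
  filter_upwards [eventually_le_log 3, eventually_ge_atTop (2 ^ (k₀ + 1))] with n hn hn'
  have hn0 : n ≠ 0 := by
    rintro rfl
    simp at hn'
  have hk1 : 2 ^ Nat.log 2 n ≤ n := Nat.pow_log_le_self 2 hn0
  have hk2 : n < 2 ^ (Nat.log 2 n + 1) := Nat.lt_pow_succ_log_self one_lt_two n
  have hk3 : k₀ + 1 ≤ Nat.log 2 n := (Nat.le_log_iff_pow_le one_lt_two hn0).2 hn'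
  have h1 := hk₀ (Nat.log 2 n) (by omega)
  have h2 := log_le_two_mul_log_log hk1 hn
  generalize Nat.log 2 n = k at *
  simp only [not_and, not_exists, not_le] at h1
  refine (h1 (by omega) n hk2.le).le.trans ?_
  have h16 : (4 : ℝ) * √c = √(16 * c) := by
    rw [Real.sqrt_mul (by norm_num), show (16 : ℝ) = 4 ^ 2 by norm_num,
      Real.sqrt_sq (by norm_num)]
  rw [h16, ← Real.sqrt_mul (by positivity)]
  refine Real.sqrt_le_sqrt ?_
  have hk1' : (2 : ℝ) ^ k ≤ n := by exact_mod_cast hk1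
  calc 8 * c * 2 ^ k * Real.log (k + 1) ≤ 8 * c * n * (2 * Real.log (Real.log n)) := by
        have := hlog k
        gcongr
    _ = 16 * c * (n * Real.log (Real.log n)) := by ring

end Snowflake

namespace Snowflake

/-! ### Sums of independent random variables: lower bound in the law of the iterated logarithm -/

/-- Sums over disjoint blocks of independent random variables are independent. -/
theorem iIndepFun_block_sums {Ω ι : Type*} [MeasurableSpace Ω] {P : Measure Ω}
    [IsProbabilityMeasure P] {X : ℕ → Ω → ℝ} (hX : ∀ n, Measurable (X n)) (hindep : iIndepFun X P)
    {T : ι → Finset ℕ} (hT : Pairwise fun j k => Disjoint (T j) (T k)) :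
    iIndepFun (fun k ω => ∑ i ∈ T k, X i ω) P := by
  classical
  rw [iIndepFun_iff_measure_inter_preimage_eq_mul]
  intro S sets hS
  induction S using Finset.induction_on with
  | empty => simp
  | insert k S hk ih =>
    have hdisj : Disjoint ((T k : Finset ℕ) : Set ℕ) (⋃ j ∈ S, (T j : Set ℕ)) := by
      rw [Set.disjoint_iUnion₂_right]
      intro j hj
      exact Finset.disjoint_coe.2 (hT (fun h => hk (h ▸ hj)))
    -- The new block sum is measurable for the indices of its block, the earlier ones for a disjoint
    -- set of indices.
    have hI := indep_iSup_of_disjoint (fun i => (hX i).comap_le) hindep hdisj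
    have hmeas : ∀ (R : Set ℕ) (F : Finset ℕ), (F : Set ℕ) ⊆ R →
        Measurable[⨆ i ∈ R, MeasurableSpace.comap (X i) inferInstance]
          fun ω => ∑ i ∈ F, X i ω := by
      intro R F hF
      refine Finset.measurable_fun_sum _ fun i hi => ?_
      exact (comap_measurable (X i)).mono
        (le_biSup (fun i => MeasurableSpace.comap (X i) inferInstance) (hF hi)) le_rfl
    rw [Finset.set_biInter_insert, Finset.prod_insert hk,
      ← ih fun i hi => hS i (Finset.mem_insert_of_mem hi)]
    refine (Indep_iff _ _ P).1 hI _ _ ?_ ?_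
    · exact hmeas _ _ subset_rfl (hS k (Finset.mem_insert_self k S))
    · refine Finset.measurableSet_biInter S fun j hj => ?_
      exact hmeas _ _ (Set.subset_biUnion_of_mem (u := fun j => (T j : Set ℕ)) hj)
        (hS j (Finset.mem_insert_of_mem hj))

/-- The law of the sum over a block depends only on the length of the block. -/
theorem measure_block_sum_ge {Ω : Type*} [MeasurableSpace Ω] {P : Measure Ω}
    [IsProbabilityMeasure P] {X : ℕ → Ω → ℝ} (hindep : iIndepFun X P)
    (hident : ∀ i, IdentDistrib (X i) (X 0) P P) (a m : ℕ) (y : ℝ) :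
    P {ω | y ≤ ∑ i ∈ Finset.Ico a (a + m), X i ω} = P {ω | y ≤ ∑ i ∈ Finset.range m, X i ω} := by
  have h1 : IdentDistrib (fun ω i => X (a + i) ω) (fun ω i => X i ω) P P :=
    IdentDistrib.pi (X := fun i => X (a + i)) (fun i => (hident (a + i)).trans (hident i).symm)
      (hindep.precomp (add_right_injective a)) hindep
  have h2 : MeasurableSet {x : ℕ → ℝ | y ≤ ∑ i ∈ Finset.range m, x i} :=
    measurableSet_le measurable_const (by fun_prop)
  have h3 := h1.measure_mem_eq h2
  rw [← Set.preimage_ofPred_eq, ← Set.preimage_ofPred_eq] at *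
  simp only [Finset.sum_Ico_eq_sum_range, add_tsub_cancel_left]
  exact h3

/-- Cut the block into r consecutive blocks of length m: if each sums to at least y, the total is at
least r y, and these r events are independent with the same probability. -/
theorem pow_le_measure_block_sum_ge {Ω : Type*} [MeasurableSpace Ω] {P : Measure Ω}
    [IsProbabilityMeasure P] {X : ℕ → Ω → ℝ} (hX : ∀ n, Measurable (X n)) (hindep : iIndepFun X P)
    (hident : ∀ i, IdentDistrib (X i) (X 0) P P) (a m r : ℕ) (y : ℝ) :
    P {ω | y ≤ ∑ i ∈ Finset.range m, X i ω} ^ r ≤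
      P {ω | r * y ≤ ∑ i ∈ Finset.Ico a (a + r * m), X i ω} := by
  have hT : Pairwise fun j k : ℕ =>
      Disjoint (Finset.Ico (a + j * m) (a + j * m + m)) (Finset.Ico (a + k * m) (a + k * m + m)) := by
    have key : ∀ j k : ℕ, j < k →
      Disjoint (Finset.Ico (a + j * m) (a + j * m + m))
        (Finset.Ico (a + k * m) (a + k * m + m)) := by
      intro j k hjk
      rw [Finset.disjoint_left]
      intro x hx hx'
      rw [Finset.mem_Ico] at hx hx'
      have : (j + 1) * m ≤ k * m := Nat.mul_le_mul_right m hjk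
      rw [add_mul, one_mul] at this
      omega
    intro j k hjk
    rcases lt_or_gt_of_ne hjk with h | h
    · exact key j k h
    · exact (key k j h).symm
  have hI := iIndepFun_block_sums hX hindep hT
  have hprod := hI.measure_inter_preimage_eq_mul (Finset.range r)
    (sets := fun _ => Set.Ici y) fun _ _ => measurableSet_Ici
  have heach : ∀ j, P ((fun ω => ∑ i ∈ Finset.Ico (a + j * m) (a + j * m + m), X i ω) ⁻¹'
      Set.Ici y) = P {ω | y ≤ ∑ i ∈ Finset.range m, X i ω} := fun j =>
    measure_block_sum_ge hindep hident (a + j * m) m y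
  simp only [heach, Finset.prod_const, Finset.card_range] at hprod
  rw [← hprod]
  refine measure_mono fun ω hω => ?_
  have hω' : ∀ j < r, y ≤ ∑ i ∈ Finset.Ico (a + j * m) (a + j * m + m), X i ω := fun j hj =>
    Set.mem_iInter₂.1 hω j (Finset.mem_range.2 hj)
  have hsum : ∀ s ≤ r, (s : ℝ) * y ≤ ∑ i ∈ Finset.Ico a (a + s * m), X i ω := by
    intro s
    induction s with
    | zero => simp
    | succ s ih =>
      intro hs
      have h1 := ih (by omega)
      have h2 := hω' s hs
      rw [show a + (s + 1) * m = a + s * m + m by ring,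
        ← Finset.sum_Ico_consecutive _ (show a ≤ a + s * m by omega)
          (show a + s * m ≤ a + s * m + m by omega)]
      push_cast
      linarith
  exact hsum r le_rfl

/-- A consequence of the central limit theorem. -/
theorem exists_le_measure_sum_ge {Ω : Type*} [MeasurableSpace Ω] {P : Measure Ω}
    [IsProbabilityMeasure P] {X : ℕ → Ω → ℝ} (hindep : iIndepFun X P)
    (hident : ∀ i, IdentDistrib (X i) (X 0) P P) (hL2 : MemLp (X 0) 2 P)
    (hmean : ∫ ω, X 0 ω ∂P = 0) (hvar : variance (X 0) P ≠ 0) :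
    ∃ p : ℝ, 0 < p ∧ p < 1 ∧ ∀ᶠ m : ℕ in atTop,
      ENNReal.ofReal p ≤ P {ω | √m ≤ ∑ i ∈ Finset.range m, X i ω} := by
  have hv : (variance (X 0) P).toNNReal ≠ 0 :=
    (Real.toNNReal_pos.2 ((variance_nonneg _ _).lt_of_ne' hvar)).ne'
  have hclt := (tendstoInDistribution_inv_sqrt_mul_sum_sub (Y := id)
    (P' := gaussianReal 0 (variance (X 0) P).toNNReal) HasLaw.id hL2 hindep hident).tendsto
  -- Portmanteau on the open half-line (1, ∞), which a nondegenerate Gaussian charges.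
  have hport := ProbabilityMeasure.le_liminf_measure_open_of_tendsto hclt
    (isOpen_Ioi (a := (1 : ℝ)))
  simp only [ProbabilityMeasure.coe_mk, Measure.map_id] at hport
  have hpos : 0 < gaussianReal 0 (variance (X 0) P).toNNReal (Set.Ioi 1) := by
    have := (gaussianReal_absolutelyContinuous' 0 hv).isOpenPosMeasure
    exact isOpen_Ioi.measure_pos _ Set.nonempty_Ioi
  obtain ⟨q, hq0, hq⟩ := ENNReal.lt_iff_exists_nnreal_btwn.1 hpos
  have hev := eventually_lt_of_lt_liminf (hq.trans_le hport)
  have hq0' : (0 : ℝ) < q := by exact_mod_cast hq0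
  -- The cap 1/2 only ensures p < 1, so that log p < 0 later.
  refine ⟨min q (1 / 2), by positivity, lt_of_le_of_lt (min_le_right _ _) (by norm_num), ?_⟩
  filter_upwards [hev, eventually_ge_atTop 1] with m hm hm1
  have hm1' : (0 : ℝ) < √m := Real.sqrt_pos.2 (by exact_mod_cast hm1)
  have hae : ∀ i, AEMeasurable (X i) P := fun i => (hident i).aemeasurable_fst
  rw [Measure.map_apply_of_aemeasurable (by fun_prop) measurableSet_Ioi] at hm
  calc ENNReal.ofReal (min q (1 / 2)) ≤ ENNReal.ofReal q :=
        ENNReal.ofReal_le_ofReal (min_le_left _ _)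
    _ = q := ENNReal.ofReal_coe_nnreal
    _ ≤ _ := hm.le.trans (measure_mono fun ω hω => ?_)
  rw [Set.mem_preimage, Set.mem_Ioi, hmean, mul_zero, sub_zero, inv_mul_eq_div,
    one_lt_div hm1'] at hω
  exact hω.le

end Snowflake

/-! ### Elementary estimates and the proof of the lower bound in the law of the iterated logarithm.
-/

namespace Snowflake

theorem mul_sqrt_eq {a : ℝ} (ha : 0 ≤ a) (x : ℝ) : a * √x = √(a ^ 2 * x) := by
  rw [Real.sqrt_mul (sq_nonneg a), Real.sqrt_sq ha]

/-- The number of sub-blocks is negligible against the length q^k, so the sub-blocks become long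
enough for the central limit theorem. -/
theorem eventually_mul_floor_log_le_pow (C θ : ℝ) (hC : 0 ≤ C) (hθ : 0 ≤ θ) {q : ℕ} (hq : 2 ≤ q) :
    ∀ᶠ k : ℕ in atTop, C * (⌊θ * Real.log (k + 1)⌋₊ + 1 : ℕ) ≤ (q : ℝ) ^ k := by
  have h1 : Tendsto (fun k : ℕ => (k : ℝ) ^ 1 / 2 ^ k) atTop (𝓝 0) :=
    tendsto_pow_const_div_const_pow_of_one_lt 1 one_lt_two
  have h2 : Tendsto (fun k : ℕ => (1 / 2 : ℝ) ^ k) atTop (𝓝 0) :=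
    tendsto_pow_atTop_nhds_zero_of_lt_one (by norm_num) (by norm_num)
  have h3 := (h1.const_mul (C * θ)).add (h2.const_mul C)
  simp only [mul_zero, add_zero] at h3
  filter_upwards [h3.eventually_le_const one_pos] with k hk
  have hk0 : (0 : ℝ) ≤ k := by positivity
  have hlog0 : 0 ≤ Real.log ((k : ℝ) + 1) := Real.log_nonneg (by linarith)
  have hlog : Real.log ((k : ℝ) + 1) ≤ k := by
    have := Real.log_le_sub_one_of_pos (show (0 : ℝ) < k + 1 by positivity)
    linarith
  have hfl := Nat.floor_le (mul_nonneg hθ hlog0)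
  have h2k : (0 : ℝ) < 2 ^ k := by positivity
  have h4 : C * θ * k + C ≤ 2 ^ k := by
    rw [one_div, inv_pow, pow_one, ← div_eq_mul_inv, ← mul_div_assoc, ← add_div,
      div_le_one h2k] at hk
    exact hk
  calc C * (⌊θ * Real.log (k + 1)⌋₊ + 1 : ℕ) ≤ C * (θ * k + 1) := by
        push_cast
        gcongr
        exact hfl.trans (by gcongr)
    _ = C * θ * k + C := by ring
    _ ≤ 2 ^ k := h4
    _ ≤ (q : ℝ) ^ k := by
        have : (2 : ℝ) ≤ q := by exact_mod_cast hq
        gcongr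

/-- With θ = 1/(−log p) one has p^(θ log(k+1)) = 1/(k+1): this many independent events of
probability p still leave a divergent series. -/
theorem div_le_pow_floor {p : ℝ} (hp0 : 0 < p) (hp1 : p < 1) (k : ℕ) :
    p / (k + 1) ≤ p ^ (⌊(-Real.log p)⁻¹ * Real.log (k + 1)⌋₊ + 1) := by
  have hlp : 0 < -Real.log p := neg_pos.2 (Real.log_neg hp0 hp1)
  have hk0 : (0 : ℝ) ≤ k := by positivity
  have hlog0 : 0 ≤ Real.log ((k : ℝ) + 1) := Real.log_nonneg (by linarith)
  have hfl := Nat.floor_le (mul_nonneg (inv_pos.2 hlp).le hlog0)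
  rw [pow_succ', div_eq_mul_inv]
  refine mul_le_mul_of_nonneg_left ?_ hp0.le
  have h1 : ((k : ℝ) + 1)⁻¹ = p ^ ((-Real.log p)⁻¹ * Real.log (k + 1)) := by
    rw [Real.rpow_def_of_pos hp0]
    have : Real.log p * ((-Real.log p)⁻¹ * Real.log (k + 1)) = -Real.log (k + 1) := by
      have : Real.log p ≠ 0 := by linarith
      field_simp
    rw [this, Real.exp_neg, Real.exp_log (by positivity)]
  rw [h1, ← Real.rpow_natCast]
  exact Real.rpow_le_rpow_of_exponent_ge hp0 hp1.le hfl

theorem tsum_div_succ_eq_top {p : ℝ} (hp : 0 < p) (k₀ : ℕ) :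
    ∑' k : ℕ, ENNReal.ofReal (p / ((k + k₀ : ℕ) + 1)) = ⊤ := by
  by_contra h
  have h1 : Summable fun k : ℕ => p / (((k + k₀ : ℕ) : ℝ) + 1) := by
    have := ENNReal.summable_toReal h
    refine this.congr fun k => ENNReal.toReal_ofReal (by positivity)
  have h2 : Summable fun k : ℕ => ((k + (k₀ + 1) : ℕ) : ℝ)⁻¹ := by
    refine (h1.mul_left p⁻¹).congr fun k => ?_
    push_cast
    field_simp
    ring
  exact Real.not_summable_natCast_inv ((summable_nat_add_iff (k₀ + 1)).1 h2)

theorem log_log_pow_le {q n k : ℕ} (hn : n ≤ q ^ (k + 1)) (hn3 : 1 ≤ Real.log n)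
    (hk : Real.log q ≤ k + 1) : Real.log (Real.log n) ≤ 2 * Real.log (k + 1) := by
  have hk0 : (0 : ℝ) ≤ k := by positivity
  have hn0 : (0 : ℝ) < n := by
    rcases Nat.eq_zero_or_pos n with rfl | h
    · norm_num at hn3
    · exact_mod_cast h
  have h1 : Real.log n ≤ (k + 1) * Real.log q := by
    have := Real.log_le_log hn0 (show (n : ℝ) ≤ (q : ℝ) ^ (k + 1) by exact_mod_cast hn)
    rw [Real.log_pow] at this
    exact_mod_cast this
  have h2 : Real.log n ≤ ((k : ℝ) + 1) ^ 2 := by nlinarith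
  have := Real.log_le_log (by linarith) h2
  rwa [Real.log_pow] at this

open scoped NNReal in
/-- The lower half of the law of the iterated logarithm, with a constant that is not sharp. -/
theorem ae_frequently_le_sum {Ω : Type*} [MeasurableSpace Ω] {P : Measure Ω}
    [IsProbabilityMeasure P] {X : ℕ → Ω → ℝ} {c : ℝ≥0} (hX : ∀ n, Measurable (X n))
    (hindep : iIndepFun X P) (hident : ∀ i, IdentDistrib (X i) (X 0) P P)
    (hsub : ∀ n, HasSubgaussianMGF (X n) c P)
    (hmean : ∀ n, ∫ ω, X n ω ∂P = 0) (hc : 0 < c) (hvar : variance (X 0) P ≠ 0) :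
    ∃ C : ℝ, 0 < C ∧ ∀ᵐ ω ∂P, ∃ᶠ n : ℕ in atTop,
      C * √(n * Real.log (Real.log n)) ≤ ∑ i ∈ Finset.range n, X i ω := by
  have hc' : (0 : ℝ) < c := hc
  obtain ⟨p, hp0, hp1, hp⟩ := exists_le_measure_sum_ge hindep hident ((hsub 0).memLp 2)
    (hmean 0) hvar
  set θ : ℝ := (-Real.log p)⁻¹ with hθ
  have hθ0 : 0 < θ := inv_pos.2 (neg_pos.2 (Real.log_neg hp0 hp1))
  set K : ℝ := 4 * √c with hK
  have hK0 : 0 < K := by positivity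
  -- The bound 3 makes the block from q^k to q^(k+1) at least twice q^k long; the other bound makes
  -- the sum before the block at most half, in size, of the gain on it.
  obtain ⟨q, hq⟩ := exists_nat_ge (max 3 (32 * K ^ 2 / θ))
  have hq3 : (3 : ℝ) ≤ q := (le_max_left _ _).trans hq
  have hq3' : 3 ≤ q := by exact_mod_cast hq3
  have hqK : 32 * K ^ 2 ≤ θ * q := by
    have := (le_max_right _ _).trans hq
    rwa [div_le_iff₀ hθ0, mul_comm (q : ℝ)] at this
  -- `r k` sub-blocks of length `m k`, each of sum at least √(m k), give `r k * √(m k)`, of order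
  -- √(q^(k+1) log k).
  let r : ℕ → ℕ := fun k => ⌊θ * Real.log (k + 1)⌋₊ + 1
  let m : ℕ → ℕ := fun k => (q ^ (k + 1) - q ^ k) / r k
  have hN : ∀ k, 2 * q ^ k ≤ q ^ (k + 1) - q ^ k := by
    intro k
    have : 3 * q ^ k ≤ q ^ (k + 1) := by
      rw [pow_succ, mul_comm]; exact Nat.mul_le_mul_left _ hq3'
    omega
  have hrm : ∀ k, r k * m k ≤ q ^ (k + 1) - q ^ k := fun k => Nat.mul_div_le _ _
  have hrm' : ∀ k, q ^ (k + 1) - q ^ k < r k * m k + r k := fun k => by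
    have := Nat.lt_mul_div_succ (q ^ (k + 1) - q ^ k) (show 0 < r k from Nat.succ_pos _)
    rwa [mul_add, mul_one] at this
  have hend : ∀ k, q ^ k + r k * m k ≤ q ^ (k + 1) := fun k => by
    have := hN k
    have := hrm k
    omega
  -- the block sums are large with a probability that is not summable
  have hT : Pairwise fun j k : ℕ => Disjoint (Finset.Ico (q ^ j) (q ^ j + r j * m j))
      (Finset.Ico (q ^ k) (q ^ k + r k * m k)) := by
    have key : ∀ j k : ℕ, j < k → Disjoint (Finset.Ico (q ^ j) (q ^ j + r j * m j))
        (Finset.Ico (q ^ k) (q ^ k + r k * m k)) := by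
      intro j k hjk
      rw [Finset.disjoint_left]
      intro x hx hx'
      rw [Finset.mem_Ico] at hx hx'
      have h1 := hend j
      have h2 : q ^ (j + 1) ≤ q ^ k := Nat.pow_le_pow_right (by omega) hjk
      omega
    intro j k hjk
    rcases lt_or_gt_of_ne hjk with h | h
    · exact key j k h
    · exact (key k j h).symm
  obtain ⟨m₀, hm₀⟩ := eventually_atTop.1 hp
  have hF := eventually_mul_floor_log_le_pow (max 2 m₀) θ (by positivity) hθ0.le
    (show 2 ≤ q by omega)
  obtain ⟨k₀, hk₀⟩ := eventually_atTop.1 hF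
  have hm0 : ∀ k ≥ k₀, m₀ ≤ m k := by
    intro k hk
    have h1 : ((m₀ * r k : ℕ) : ℝ) ≤ ((q ^ k : ℕ) : ℝ) := by
      push_cast [Nat.cast_mul]
      refine le_trans ?_ (hk₀ k hk)
      exact mul_le_mul_of_nonneg_right (le_max_right _ _) (by positivity)
    have h2 : m₀ * r k ≤ q ^ k := by exact_mod_cast h1
    have h3 := hN k
    exact (Nat.le_div_iff_mul_le (show 0 < r k from Nat.succ_pos _)).2 (by omega)
  have hr2 : ∀ k ≥ k₀, 2 * r k ≤ q ^ k := by
    intro k hk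
    have h1 : ((2 * r k : ℕ) : ℝ) ≤ ((q ^ k : ℕ) : ℝ) := by
      push_cast [Nat.cast_mul]
      refine le_trans ?_ (hk₀ k hk)
      exact mul_le_mul_of_nonneg_right (le_max_left _ _) (by positivity)
    exact_mod_cast h1
  -- Shifted by `k₀` so that the asymptotic estimates hold for every index.
  let E : ℕ → Set Ω := fun k => (fun ω =>
    ∑ i ∈ Finset.Ico (q ^ (k + k₀)) (q ^ (k + k₀) + r (k + k₀) * m (k + k₀)), X i ω) ⁻¹'
      Set.Ici (r (k + k₀) * √(m (k + k₀)))
  have hEm : ∀ k, MeasurableSet (E k) := fun k =>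
    (Finset.measurable_fun_sum _ fun i _ => hX i) measurableSet_Ici
  have hEI : iIndepSet E P := by
    rw [iIndepSet_iff_meas_biInter hEm]
    intro s
    have h1 := (iIndepFun_block_sums hX hindep hT).precomp (add_left_injective k₀)
    exact h1.measure_inter_preimage_eq_mul s
      (sets := fun k => Set.Ici (r (k + k₀) * √(m (k + k₀)))) fun _ _ => measurableSet_Ici
  have hEP : ∀ k, ENNReal.ofReal (p / ((k + k₀ : ℕ) + 1)) ≤ P (E k) := by
    intro k
    refine le_trans ?_ (pow_le_measure_block_sum_ge hX hindep hident (q ^ (k + k₀))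
      (m (k + k₀)) (r (k + k₀)) (√(m (k + k₀))))
    refine (ENNReal.ofReal_le_ofReal (div_le_pow_floor hp0 hp1 (k + k₀))).trans ?_
    rw [ENNReal.ofReal_pow hp0.le]
    exact pow_le_pow_left' (hm₀ _ (hm0 _ (by omega))) _
  -- The second Borel–Cantelli lemma.
  have hE1 : P (limsup E atTop) = 1 := by
    refine measure_limsup_eq_one hEm hEI (top_unique ?_)
    rw [← tsum_div_succ_eq_top hp0 k₀]
    exact ENNReal.tsum_le_tsum hEP
  have hEae : ∀ᵐ ω ∂P, ∃ᶠ k in atTop, ω ∈ E k := by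
    have h1 : MeasurableSet (limsup E atTop) := MeasurableSet.measurableSet_limsup hEm
    have h2 := (prob_compl_eq_zero_iff h1).2 hE1
    filter_upwards [compl_mem_ae_iff.2 h2] with ω hω
    rw [compl_compl] at hω
    exact mem_limsup_iff_frequently_mem.1 hω
  -- the sum up to the beginning of the block is not too negative
  have hneg := ae_eventually_sum_le (X := fun n ω => -X n ω) (c := c)
    (fun n => (hX n).neg.stronglyMeasurable)
    (hindep.comp (fun _ x => -x) fun _ => measurable_neg) (fun n => (hsub n).neg)
    (fun n => by rw [integral_neg, hmean n, neg_zero]) hc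
  -- With Q = q^(k+1) log(k+1): the block brings at least (√θ/2)√Q, the start at least −(√θ/4)√Q,
  -- and √(n log log n) ≤ 2√Q.
  refine ⟨√θ / 8, by positivity, ?_⟩
  filter_upwards [hEae, hneg] with ω hω hωneg
  have hpow : Tendsto (fun k : ℕ => q ^ k) atTop atTop :=
    tendsto_pow_atTop_atTop_of_one_lt (by omega)
  have hpow' : Tendsto (fun k : ℕ => q ^ (k + k₀)) atTop atTop :=
    hpow.comp (tendsto_add_atTop_nat k₀)
  have hn_tendsto : Tendsto (fun k => q ^ (k + k₀) + r (k + k₀) * m (k + k₀)) atTop atTop :=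
    tendsto_atTop_mono (fun k => Nat.le_add_right _ _) hpow'
  refine hn_tendsto.frequently ?_
  refine (hω.and_eventually ((hpow'.eventually hωneg).and
    ((hpow'.eventually (eventually_le_log 1)).and
      (eventually_ge_atTop (⌈Real.log q⌉₊ + 1))))).mono ?_
  rintro j ⟨hj1, hj2, hj3, hj4⟩
  have hkk : j ≤ j + k₀ := Nat.le_add_right _ _
  have hk₀' : k₀ ≤ j + k₀ := Nat.le_add_left _ _
  have hj1' : r (j + k₀) * √(m (j + k₀)) ≤
    ∑ i ∈ Finset.Ico (q ^ (j + k₀)) (q ^ (j + k₀) + r (j + k₀) * m (j + k₀)), X i ω := hj1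
  generalize j + k₀ = k at *
  have hkq : Real.log q ≤ k := by
    have h1 := Nat.le_ceil (Real.log q)
    have h2 : ((⌈Real.log q⌉₊ : ℕ) : ℝ) ≤ k := by exact_mod_cast (by omega)
    linarith
  have hk1 : 1 ≤ k := by omega
  set n := q ^ k + r k * m k with hn
  have hn1 : q ^ k ≤ n := Nat.le_add_right _ _
  have hqk0 : (0 : ℝ) < (q : ℝ) ^ k := by positivity
  have hlogn : 1 ≤ Real.log n := hj3.trans (Real.log_le_log (by exact_mod_cast hqk0)
    (by exact_mod_cast hn1))
  have hll1 : Real.log (Real.log n) ≤ 2 * Real.log (k + 1) :=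
    log_log_pow_le (hend k) hlogn (by linarith)
  have hll2 : Real.log (Real.log (q ^ k : ℕ)) ≤ 2 * Real.log (k + 1) :=
    log_log_pow_le (Nat.pow_le_pow_right (by omega) k.le_succ) hj3 (by linarith)
  have hLk : 0 ≤ Real.log ((k : ℝ) + 1) := Real.log_nonneg (by
    have : (0 : ℝ) ≤ k := by positivity
    linarith)
  set Q : ℝ := (q : ℝ) ^ (k + 1) * Real.log (k + 1) with hQ
  have hQ0 : 0 ≤ Q := by positivity
  -- the block
  have hblock : √θ / 2 * √Q ≤ r k * √(m k) := by
    have h1 : θ * Real.log (k + 1) ≤ r k := by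
      have := (Nat.lt_floor_add_one (θ * Real.log (k + 1))).le
      simpa [r] using this
    have h2 : (q : ℝ) ^ (k + 1) / 4 ≤ r k * m k := by
      have e1 := hrm' k
      have e2 := hr2 k hk₀'
      have e3 : 3 * q ^ k ≤ q ^ (k + 1) := by
        rw [pow_succ, mul_comm]; exact Nat.mul_le_mul_left _ hq3'
      have e4 : q ^ (k + 1) ≤ 4 * (r k * m k) := by omega
      have e5 : (q : ℝ) ^ (k + 1) ≤ 4 * (r k * m k) := by exact_mod_cast e4
      linarith
    have h3 : (r k : ℝ) * √(m k) = √(r k * (r k * m k)) := by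
      rw [← mul_assoc, Real.sqrt_mul (by positivity), Real.sqrt_mul_self (by positivity)]
    have h4 : √θ / 2 * √Q = √(θ * Q / 4) := by
      rw [Real.sqrt_div' _ (by norm_num), Real.sqrt_mul hθ0.le,
        show (4 : ℝ) = 2 ^ 2 by norm_num, Real.sqrt_sq (by norm_num)]
      ring
    rw [h3, h4]
    refine Real.sqrt_le_sqrt ?_
    calc θ * Q / 4 = θ * Real.log (k + 1) * ((q : ℝ) ^ (k + 1) / 4) := by rw [hQ]; ring
      _ ≤ r k * (r k * m k) := by gcongr
  have hstart : -(√θ / 4 * √Q) ≤ ∑ i ∈ Finset.range (q ^ k), X i ω := by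
    rw [Finset.sum_neg_distrib] at hj2
    have h1 : K * √((q ^ k : ℕ) * Real.log (Real.log (q ^ k : ℕ))) ≤ √θ / 4 * √Q := by
      have h4 : √θ / 4 * √Q = √(θ * Q / 16) := by
        rw [Real.sqrt_div' _ (by norm_num), Real.sqrt_mul hθ0.le,
          show (16 : ℝ) = 4 ^ 2 by norm_num, Real.sqrt_sq (by norm_num)]
        ring
      have h5 : K * √((q ^ k : ℕ) * Real.log (Real.log (q ^ k : ℕ))) =
          √(K ^ 2 * ((q ^ k : ℕ) * Real.log (Real.log (q ^ k : ℕ)))) := mul_sqrt_eq hK0.le _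
      rw [h4, h5]
      refine Real.sqrt_le_sqrt ?_
      calc K ^ 2 * ((q ^ k : ℕ) * Real.log (Real.log (q ^ k : ℕ)))
          ≤ K ^ 2 * ((q ^ k : ℕ) * (2 * Real.log (k + 1))) := by gcongr
        _ = (32 * K ^ 2) * ((q : ℝ) ^ k * Real.log (k + 1)) / 16 := by push_cast; ring
        _ ≤ (θ * q) * ((q : ℝ) ^ k * Real.log (k + 1)) / 16 := by gcongr
        _ = θ * Q / 16 := by rw [hQ]; ring
    linarith
  have hfinal : √(n * Real.log (Real.log n)) ≤ 2 * √Q := by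
    rw [mul_sqrt_eq (by norm_num)]
    refine Real.sqrt_le_sqrt ?_
    have hnq : (n : ℝ) ≤ (q : ℝ) ^ (k + 1) := by exact_mod_cast hend k
    calc (n : ℝ) * Real.log (Real.log n) ≤ (q : ℝ) ^ (k + 1) * (2 * Real.log (k + 1)) := by
          have : 0 ≤ Real.log (Real.log n) := Real.log_nonneg hlogn
          gcongr
      _ = 2 * Q := by rw [hQ]; ring
      _ ≤ 2 ^ 2 * Q := by linarith
  have hsplit : ∑ i ∈ Finset.range n, X i ω =
      ∑ i ∈ Finset.range (q ^ k), X i ω + ∑ i ∈ Finset.Ico (q ^ k) n, X i ω :=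
    (Finset.sum_range_add_sum_Ico _ hn1).symm
  rw [hsplit]
  have hfin2 : √θ / 8 * √(n * Real.log (Real.log n)) ≤ √θ / 8 * (2 * √Q) := by gcongr
  linarith

end Snowflake

namespace Snowflake

/-! ### Comparison of the inner volume with a random walk -/

/-- The increment of the random walk that governs the inner volume. -/
def increment (γ : ℝ) (a : ℕ) : ℝ := Real.log (numPieces a) - γ * Real.log (scale a)

variable {ξ : ℕ → ℕ}

theorem log_totalScale (n : ℕ) :
    Real.log (totalScale ξ n) = ∑ i ∈ Finset.range n, Real.log (scale (ξ i)) :=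
  Real.log_prod fun _ _ => (scale_pos _).ne'

theorem totalPieces_eq (γ : ℝ) (n : ℕ) : (totalPieces ξ n : ℝ) =
    Real.exp (∑ i ∈ Finset.range n, increment γ (ξ i)) * totalScale ξ n ^ γ := by
  have h : Real.log (totalPieces ξ n) = ∑ i ∈ Finset.range n, Real.log (numPieces (ξ i)) := by
    rw [totalPieces, Nat.cast_prod]
    exact Real.log_prod fun _ _ => by simp [numPieces]; positivity
  rw [Real.rpow_def_of_pos (totalScale_pos ξ n), ← Real.exp_add, log_totalScale]
  simp only [increment, Finset.sum_sub_distrib]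
  rw [← Finset.mul_sum, ← h, mul_comm, sub_add_cancel,
    Real.exp_log (by exact_mod_cast totalPieces_pos n)]

/-- Applied to t = L_n ε in [1, b], it exchanges powers of 1/L_n for powers of ε whatever the sign
of the exponent. -/
theorem rpow_abs_bounds {t b s : ℝ} (h1 : 1 ≤ t) (h2 : t ≤ b) :
    b ^ (-|s|) ≤ t ^ s ∧ t ^ s ≤ b ^ |s| := by
  have hb : 1 ≤ b := h1.trans h2
  constructor
  · calc b ^ (-|s|) ≤ t ^ (-|s|) :=
          Real.rpow_le_rpow_of_nonpos (by linarith) h2 (by simp)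
      _ ≤ t ^ s := Real.rpow_le_rpow_of_exponent_le h1 (neg_abs_le s)
  · calc t ^ s ≤ t ^ |s| := Real.rpow_le_rpow_of_exponent_le h1 (le_abs_self s)
      _ ≤ b ^ |s| := Real.rpow_le_rpow (by linarith) h2 (abs_nonneg s)

/-- The bridge from geometry to probability; γ is still arbitrary here, and the constants do not
depend on ξ. -/
theorem exists_innerVolume_bounds (B : ℕ) (γ : ℝ) : ∃ k₁ k₂ : ℝ, 0 < k₁ ∧ 0 < k₂ ∧
    ∀ ξ : ℕ → ℕ, (∀ n, 1 ≤ ξ n) → (∀ n, ξ n ≤ B) → ∀ n : ℕ, ∀ ε : ℝ,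
      1 ≤ totalScale ξ n * ε → totalScale ξ n * ε ≤ 2 * B + 1 →
      k₁ * ε ^ (2 - γ) * Real.exp (∑ i ∈ Finset.range n, increment γ (ξ i)) ≤
        innerVolume (snowflake ξ) ε ∧
      innerVolume (snowflake ξ) ε ≤
        k₂ * ε ^ (2 - γ) * Real.exp (∑ i ∈ Finset.range n, increment γ (ξ i)) := by
  set b : ℝ := 2 * B + 1 with hb
  have hb0 : 0 < b := by positivity
  -- Here 64 b² bounds (8ℓ)² from the disc radius, and 12π is 3π · 2² from 1/L_n + ε ≤ 2ε; the
  -- powers of b come from L_n ε ∈ [1, b].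
  refine ⟨Real.pi / (64 * b ^ 2) * b ^ (-|γ - 2|), 12 * Real.pi * b ^ |γ|, by positivity,
    by positivity, fun ξ hξ1 hξB n ε h1 h2 => ?_⟩
  have hL := totalScale_pos ξ n
  have hε : 0 < ε := by
    by_contra! h
    have := mul_nonpos_of_nonneg_of_nonpos hL.le h
    linarith
  have hLε : (totalScale ξ n)⁻¹ ≤ ε := by
    rw [inv_le_iff_one_le_mul₀' hL]; exact h1
  set E := Real.exp (∑ i ∈ Finset.range n, increment γ (ξ i)) with hE
  have hM := totalPieces_eq (ξ := ξ) γ n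
  rw [← hE] at hM
  have hE0 : 0 < E := Real.exp_pos _
  have hprod : ∀ s : ℝ, (totalScale ξ n * ε) ^ s = totalScale ξ n ^ s * ε ^ s := fun s =>
    Real.mul_rpow hL.le hε.le
  constructor
  · refine le_trans ?_ (le_innerVolume hξ1 n hLε)
    have hl := scale_pos (ξ n)
    have hlb : (scale (ξ n) : ℝ) ≤ b := by
      rw [cast_scale]
      have : (ξ n : ℝ) ≤ B := by exact_mod_cast hξB n
      linarith
    have e1 : ε ^ (2 - γ) * b ^ (-|γ - 2|) ≤ totalScale ξ n ^ γ * (totalScale ξ n)⁻¹ ^ 2 := by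
      calc ε ^ (2 - γ) * b ^ (-|γ - 2|) ≤ ε ^ (2 - γ) * (totalScale ξ n * ε) ^ (γ - 2) := by
            have := (rpow_abs_bounds (s := γ - 2) h1 h2).1
            gcongr
        _ = totalScale ξ n ^ (γ - 2) * (ε ^ (2 - γ) * ε ^ (γ - 2)) := by rw [hprod]; ring
        _ = totalScale ξ n ^ (γ - 2) := by
            rw [← Real.rpow_add hε, show 2 - γ + (γ - 2) = 0 by ring, Real.rpow_zero, mul_one]
        _ = totalScale ξ n ^ γ * (totalScale ξ n)⁻¹ ^ 2 := by
            rw [Real.rpow_sub hL, Real.rpow_two, inv_pow, div_eq_mul_inv]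
    rw [hM]
    calc Real.pi / (64 * b ^ 2) * b ^ (-|γ - 2|) * ε ^ (2 - γ) * E
        = Real.pi * E * (ε ^ (2 - γ) * b ^ (-|γ - 2|)) * (1 / (8 * b)) ^ 2 := by
          field_simp; ring
      _ ≤ Real.pi * E * (totalScale ξ n ^ γ * (totalScale ξ n)⁻¹ ^ 2) *
          (1 / (8 * scale (ξ n))) ^ 2 := by gcongr
      _ = Real.pi * (E * totalScale ξ n ^ γ) *
          ((totalScale ξ n)⁻¹ * (1 / (8 * scale (ξ n)))) ^ 2 := by ring
  · refine (innerVolume_le hξ1 n hε.le).trans ?_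
    have e1 : totalScale ξ n ^ γ * ε ^ 2 ≤ ε ^ (2 - γ) * b ^ |γ| := by
      calc totalScale ξ n ^ γ * ε ^ 2 = totalScale ξ n ^ γ * (ε ^ (2 - γ) * ε ^ γ) := by
            rw [← Real.rpow_add hε, sub_add_cancel, Real.rpow_two]
        _ = ε ^ (2 - γ) * (totalScale ξ n * ε) ^ γ := by rw [hprod]; ring
        _ ≤ ε ^ (2 - γ) * b ^ |γ| := by
            have := (rpow_abs_bounds (s := γ) h1 h2).2
            gcongr
    rw [hM]
    calc 3 * Real.pi * (E * totalScale ξ n ^ γ) * ((totalScale ξ n)⁻¹ + ε) ^ 2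
        ≤ 3 * Real.pi * (E * totalScale ξ n ^ γ) * (ε + ε) ^ 2 := by gcongr
      _ = 12 * Real.pi * E * (totalScale ξ n ^ γ * ε ^ 2) := by ring
      _ ≤ 12 * Real.pi * E * (ε ^ (2 - γ) * b ^ |γ|) := by gcongr
      _ = 12 * Real.pi * b ^ |γ| * ε ^ (2 - γ) * E := by ring

theorem log_three_gt : (103 / 100 : ℝ) < Real.log 3 := by
  have h1 := Real.log_two_gt_d9
  have h2 : Real.log (2 ^ 3) < Real.log (3 ^ 2) := Real.log_lt_log (by norm_num) (by norm_num)
  rw [Real.log_pow, Real.log_pow] at h2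
  push_cast at h2
  linarith

theorem mul_log_three_le_log_totalScale (hξ : ∀ n, 1 ≤ ξ n) (n : ℕ) :
    n * Real.log 3 ≤ Real.log (totalScale ξ n) := by
  rw [← Real.log_pow]
  exact Real.log_le_log (by positivity) (three_pow_le_totalScale hξ n)

/-- For every small `ε` there is an iteration whose pieces have a length comparable to `ε`. -/
theorem eventually_exists_scale {B : ℕ} (hξ : ∀ n, 1 ≤ ξ n) (hB : ∀ n, ξ n ≤ B) (N : ℕ) :
    ∀ᶠ ε : ℝ in 𝓝[>] 0, ∃ n ≥ N, 1 ≤ totalScale ξ n * ε ∧ totalScale ξ n * ε ≤ 2 * B + 1 ∧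
      (n : ℝ) ≤ Real.log (1 / ε) := by
  have hL := totalScale_pos ξ
  have hmono : Monotone (totalScale ξ) := by
    refine monotone_nat_of_le_succ fun n => ?_
    rw [totalScale_succ, cast_scale]
    exact le_mul_of_one_le_right (hL n).le (by linarith [Nat.cast_nonneg (α := ℝ) (ξ n)])
  -- For m ≥ 36 one has m + 1 ≤ 1.03 m < m log 3, which absorbs the off-by-one in `n ≤ log (1/ε)`.
  have hmem : Set.Ioo (0 : ℝ) (totalScale ξ (max N 36))⁻¹ ∈ 𝓝[>] (0 : ℝ) :=
    Ioo_mem_nhdsGT (inv_pos.2 (hL _))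
  filter_upwards [hmem] with ε hε
  have hε0 : 0 < ε := hε.1
  classical
  have hex : ∃ n, 1 ≤ totalScale ξ n * ε := by
    obtain ⟨n, hn⟩ := ((tendsto_inv_totalScale hξ).eventually_lt_const hε0).exists
    refine ⟨n, ?_⟩
    rw [← inv_le_iff_one_le_mul₀' (hL n)]
    exact hn.le
  have hlt : max N 36 < Nat.find hex := by
    by_contra! h
    have h1 := Nat.find_spec hex
    have h2 := hmono h
    have h3 : totalScale ξ (max N 36) * ε < 1 := by
      have := hε.2
      rwa [lt_inv_comm₀ hε0 (hL _), ← one_div, lt_div_iff₀ hε0] at this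
    nlinarith
  have hspec := Nat.find_spec hex
  -- By minimality L_m ε < 1, and one more factor is at most 2B + 1.
  obtain ⟨m, hm⟩ : ∃ m, Nat.find hex = m + 1 := ⟨Nat.find hex - 1, by omega⟩
  have hmin := Nat.find_min hex (m := m) (by omega)
  rw [hm] at hspec hlt
  push Not at hmin
  refine ⟨m + 1, by omega, hspec, ?_, ?_⟩
  · rw [totalScale_succ, cast_scale]
    have : (ξ m : ℝ) ≤ B := by exact_mod_cast hB m
    nlinarith
  · have h1 : totalScale ξ m ≤ 1 / ε := by
      rw [le_div_iff₀ hε0]; exact hmin.le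
    have h2 := Real.log_le_log (hL m) h1
    have h3 := mul_log_three_le_log_totalScale hξ m
    have h4 := log_three_gt
    have h5 : (36 : ℝ) ≤ m := by
      have : 36 ≤ m := by omega
      exact_mod_cast this
    push_cast
    nlinarith

theorem sqrt_le_psi {n : ℕ} {ε : ℝ} (hn : 3 ≤ n) (h : (n : ℝ) ≤ Real.log (1 / ε)) :
    √(n * Real.log (Real.log n)) ≤ psi (1 / ε) := by
  have hn3 : (3 : ℝ) ≤ n := by exact_mod_cast hn
  have h1 : 1 ≤ Real.log n := by
    have := Real.log_le_log (by norm_num) hn3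
    linarith [log_three_gt]
  have h2 : Real.log n ≤ Real.log (Real.log (1 / ε)) := Real.log_le_log (by linarith) h
  have h3 := Real.log_le_log (by linarith) h2
  have h0 : 0 ≤ Real.log (Real.log n) := Real.log_nonneg h1
  have hy : 0 ≤ Real.log (1 / ε) := by linarith
  exact Real.sqrt_le_sqrt (by gcongr)

/-- At the scale of the pieces, `ψ` is at most of the order of `√(n log log n)`. -/
theorem eventually_psi_le {B : ℕ} (hξ : ∀ n, 1 ≤ ξ n) (hB : ∀ n, ξ n ≤ B) :
    ∀ᶠ n : ℕ in atTop, psi (totalScale ξ n) ≤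
      √(2 * Real.log (2 * B + 1)) * √(n * Real.log (Real.log n)) := by
  set β : ℝ := Real.log (2 * B + 1) with hβ
  have hβ0 : 0 ≤ β := Real.log_nonneg (by linarith [Nat.cast_nonneg (α := ℝ) B])
  filter_upwards [eventually_le_log 2, eventually_ge_atTop (⌈β⌉₊ + 3)] with n hn hn'
  have hnβ : β ≤ n := by
    have h1 := Nat.le_ceil β
    have h2 : ((⌈β⌉₊ : ℕ) : ℝ) ≤ n := by exact_mod_cast (by omega)
    linarith
  have hn3 : (3 : ℝ) ≤ n := by exact_mod_cast (by omega)
  have hup : Real.log (totalScale ξ n) ≤ n * β := by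
    rw [log_totalScale]
    have : ∀ i ∈ Finset.range n, Real.log (scale (ξ i)) ≤ β := by
      intro i _
      refine Real.log_le_log (scale_pos _) ?_
      have : (ξ i : ℝ) ≤ B := by exact_mod_cast hB i
      rw [cast_scale]; linarith
    simpa using Finset.sum_le_sum this
  have hlow : (n : ℝ) ≤ Real.log (totalScale ξ n) := by
    have := mul_log_three_le_log_totalScale hξ n
    have h4 := log_three_gt
    nlinarith
  have hβpos : 0 < β := by
    by_contra! h
    have : n * β ≤ 0 := mul_nonpos_of_nonneg_of_nonpos (by linarith) h
    linarith
  -- The square costs only a factor 2 after one more logarithm.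
  have h1 : Real.log (Real.log (totalScale ξ n)) ≤ Real.log n ^ 2 := by
    calc Real.log (Real.log (totalScale ξ n)) ≤ Real.log (n * β) :=
          Real.log_le_log (by linarith) hup
      _ = Real.log n + Real.log β := Real.log_mul (by linarith) hβpos.ne'
      _ ≤ Real.log n + Real.log n := by
          have := Real.log_le_log hβpos hnβ
          linarith
      _ ≤ Real.log n ^ 2 := by nlinarith
  have h2 : Real.log n ≤ Real.log (Real.log (totalScale ξ n)) :=
    Real.log_le_log (by linarith) hlow
  have h3 := Real.log_le_log (by linarith) h1
  rw [Real.log_pow] at h3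
  push_cast at h3
  have h4 : 0 ≤ Real.log (Real.log n) := Real.log_nonneg (by linarith)
  rw [psi, ← Real.sqrt_mul (by positivity)]
  refine Real.sqrt_le_sqrt ?_
  have h5 : 0 ≤ Real.log (totalScale ξ n) := by linarith
  have h6 : 0 ≤ Real.log (Real.log (Real.log (totalScale ξ n))) := Real.log_nonneg (by linarith)
  calc Real.log (totalScale ξ n) * Real.log (Real.log (Real.log (totalScale ξ n)))
      ≤ (n * β) * (2 * Real.log (Real.log n)) := by gcongr
    _ = 2 * β * (n * Real.log (Real.log n)) := by ring

/-! ### The Minkowski dimension -/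

theorem tendsto_log_inv : Tendsto (fun ε : ℝ => Real.log (1 / ε)) (𝓝[>] 0) atTop := by
  simp only [one_div]
  exact Real.tendsto_log_atTop.comp tendsto_inv_nhdsGT_zero

/-- With y = log(1/ε), log log y ≤ log y bounds the quotient by √(log y / y). -/
theorem tendsto_psi_div_log :
    Tendsto (fun ε : ℝ => psi (1 / ε) / Real.log (1 / ε)) (𝓝[>] 0) (𝓝 0) := by
  have h1 : Tendsto (fun y : ℝ => Real.log y / y) atTop (𝓝 0) :=
    Real.isLittleO_log_id_atTop.tendsto_div_nhds_zero
  have h2 : Tendsto (fun y : ℝ => √(y * Real.log (Real.log y)) / y) atTop (𝓝 0) := by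
    have h3 : Tendsto (fun y : ℝ => √(Real.log y / y)) atTop (𝓝 0) := by
      have := (Real.continuous_sqrt.tendsto 0).comp h1
      rwa [Real.sqrt_zero] at this
    refine squeeze_zero' ?_ ?_ h3
    · filter_upwards [eventually_gt_atTop 0] with y hy
      positivity
    · filter_upwards [eventually_gt_atTop 1] with y hy
      have hy0 : 0 < y := by linarith
      have hlog : Real.log (Real.log y) ≤ Real.log y := by
        have := Real.log_le_sub_one_of_pos (Real.log_pos hy)
        linarith
      calc √(y * Real.log (Real.log y)) / y ≤ √(y * Real.log y) / y := by gcongr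
        _ = √(Real.log y / y) := by
            rw [div_eq_iff hy0.ne', mul_comm (√_), mul_sqrt_eq hy0.le]
            congr 1
            field_simp
  exact h2.comp tendsto_log_inv

theorem hasInnerMinkowskiDim_of_bounds {D : Set ℂ} {γ c₁ c₂ c₃ : ℝ} (h₁ : 0 < c₁) (h₃ : 0 < c₃)
    (h : ∀ᶠ ε : ℝ in 𝓝[>] 0,
      c₁ * ε ^ (2 - γ) * Real.exp (-(c₂ * psi (1 / ε))) ≤ innerVolume D ε ∧
      innerVolume D ε ≤ c₃ * ε ^ (2 - γ) * Real.exp (c₂ * psi (1 / ε))) :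
    HasInnerMinkowskiDim D γ := by
  have hlim : Tendsto (fun ε : ℝ => Real.log (innerVolume D ε) / Real.log ε) (𝓝[>] 0)
      (𝓝 (2 - γ)) := by
    have hy := tendsto_log_inv
    have hpsi := tendsto_psi_div_log
    have hinv : Tendsto (fun ε : ℝ => (Real.log (1 / ε))⁻¹) (𝓝[>] 0) (𝓝 0) :=
      hy.inv_tendsto_atTop
    have hlow : Tendsto (fun ε : ℝ => (2 - γ) - Real.log c₃ * (Real.log (1 / ε))⁻¹ -
        c₂ * (psi (1 / ε) / Real.log (1 / ε))) (𝓝[>] 0) (𝓝 (2 - γ)) := by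
      have := ((tendsto_const_nhds (x := 2 - γ)).sub (hinv.const_mul (Real.log c₃))).sub
        (hpsi.const_mul c₂)
      simpa using this
    have hupp : Tendsto (fun ε : ℝ => (2 - γ) - Real.log c₁ * (Real.log (1 / ε))⁻¹ +
        c₂ * (psi (1 / ε) / Real.log (1 / ε))) (𝓝[>] 0) (𝓝 (2 - γ)) := by
      have := ((tendsto_const_nhds (x := 2 - γ)).sub (hinv.const_mul (Real.log c₁))).add
        (hpsi.const_mul c₂)
      simpa using this
    refine tendsto_of_tendsto_of_tendsto_of_le_of_le' hlow hupp ?_ ?_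
    · filter_upwards [h, hy.eventually_gt_atTop 0, self_mem_nhdsWithin] with ε hε hy0 hε0
      have hε0' : (0 : ℝ) < ε := hε0
      have hp : 0 < ε ^ (2 - γ) := Real.rpow_pos_of_pos hε0' _
      have h2 := Real.log_le_log (lt_of_lt_of_le (by positivity) hε.1) hε.2
      rw [Real.log_mul (by positivity) (Real.exp_pos _).ne', Real.log_mul h₃.ne' hp.ne',
        Real.log_exp, Real.log_rpow hε0'] at h2
      -- The negative denominator reverses inequalities: the upper bound on the area gives the lower
      -- bound on the quotient.
      have hlog : Real.log ε = -Real.log (1 / ε) := by rw [one_div, Real.log_inv, neg_neg]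
      rw [hlog] at h2 ⊢
      generalize Real.log (1 / ε) = y at *
      rw [div_neg, ← neg_div, le_div_iff₀ hy0]
      have e : (2 - γ - Real.log c₃ * y⁻¹ - c₂ * (psi (1 / ε) / y)) * y =
          (2 - γ) * y - Real.log c₃ - c₂ * psi (1 / ε) := by field_simp
      rw [e]; linarith
    · filter_upwards [h, hy.eventually_gt_atTop 0, self_mem_nhdsWithin] with ε hε hy0 hε0
      have hε0' : (0 : ℝ) < ε := hε0
      have hp : 0 < ε ^ (2 - γ) := Real.rpow_pos_of_pos hε0' _
      have h2 := Real.log_le_log (by positivity) hε.1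
      rw [Real.log_mul (by positivity) (Real.exp_pos _).ne', Real.log_mul h₁.ne' hp.ne',
        Real.log_exp, Real.log_rpow hε0'] at h2
      have hlog : Real.log ε = -Real.log (1 / ε) := by rw [one_div, Real.log_inv, neg_neg]
      rw [hlog] at h2 ⊢
      generalize Real.log (1 / ε) = y at *
      rw [div_neg, ← neg_div, div_le_iff₀ hy0]
      have e : (2 - γ - Real.log c₁ * y⁻¹ + c₂ * (psi (1 / ε) / y)) * y =
          (2 - γ) * y - Real.log c₁ + c₂ * psi (1 / ε) := by field_simp
      rw [e]; linarith
  have hE : Tendsto (fun ε : ℝ => ((Real.log (innerVolume D ε) / Real.log ε : ℝ) : EReal))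
      (𝓝[>] 0) (𝓝 ((2 - γ : ℝ) : EReal)) := (continuous_coe_real_ereal.tendsto _).comp hlim
  have h2 : (2 : EReal) - ((2 - γ : ℝ) : EReal) = (γ : EReal) := by
    rw [show (2 : EReal) = ((2 : ℝ) : EReal) from rfl, ← EReal.coe_sub, sub_sub_cancel]
  exact ⟨by rw [innerLowerMinkowskiDim, hE.limsup_eq, h2],
    by rw [innerUpperMinkowskiDim, hE.liminf_eq, h2]⟩

end Snowflake

namespace Snowflake

/-! ### Injectivity of the dimension of the building block -/

/-- With u = log(2x+1) and v = log(3x+1), the derivative has the sign of u − (6x+2)(v − u); and v −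
u ≥ 1/4 while u < (6x+2)/4. -/
theorem strictAntiOn_log_div_log :
    StrictAntiOn (fun x : ℝ => Real.log (3 * x + 1) / Real.log (2 * x + 1)) (Set.Ici 1) := by
  have hderiv : ∀ x : ℝ, 1 ≤ x → HasDerivAt
      (fun x : ℝ => Real.log (3 * x + 1) / Real.log (2 * x + 1))
      ((3 / (3 * x + 1) * Real.log (2 * x + 1) - Real.log (3 * x + 1) * (2 / (2 * x + 1))) /
        Real.log (2 * x + 1) ^ 2) x := by
    intro x hx
    have h1 : HasDerivAt (fun x : ℝ => 3 * x + 1) 3 x := by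
      simpa using ((hasDerivAt_id x).const_mul 3).add_const 1
    have h2 : HasDerivAt (fun x : ℝ => 2 * x + 1) 2 x := by
      simpa using ((hasDerivAt_id x).const_mul 2).add_const 1
    exact (h1.log (by positivity)).div (h2.log (by positivity))
      (Real.log_pos (by linarith)).ne'
  refine strictAntiOn_of_deriv_neg (convex_Ici 1)
    (fun x hx => (hderiv x hx).continuousAt.continuousWithinAt) fun x hx => ?_
  rw [interior_Ici, Set.mem_Ioi] at hx
  rw [(hderiv x hx.le).deriv]
  have hu : 0 < Real.log (2 * x + 1) := Real.log_pos (by linarith)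
  refine div_neg_of_neg_of_pos ?_ (by positivity)
  have h1 : (1 : ℝ) / 4 ≤ Real.log (3 * x + 1) - Real.log (2 * x + 1) := by
    rw [← Real.log_div (by positivity) (by positivity)]
    have h := Real.one_sub_inv_le_log_of_pos
      (show (0 : ℝ) < (3 * x + 1) / (2 * x + 1) by positivity)
    refine le_trans ?_ h
    rw [inv_div, one_sub_div (by positivity), div_le_div_iff₀ (by norm_num) (by positivity)]
    linarith
  have h2 : Real.log (2 * x + 1) < 3 / 2 * x + 1 / 2 := by
    -- The tangent to the logarithm at 3, the value of 2x + 1 at x = 1.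
    have h := Real.log_le_sub_one_of_pos (show (0 : ℝ) < (2 * x + 1) / 3 by positivity)
    rw [Real.log_div (by positivity) (by norm_num)] at h
    have h3 : Real.log 3 ≤ Real.log (2 ^ 2) := Real.log_le_log (by norm_num) (by norm_num)
    rw [Real.log_pow] at h3
    push_cast at h3
    have h4 := Real.log_two_lt_d9
    linarith
  have e : 3 / (3 * x + 1) * Real.log (2 * x + 1) - Real.log (3 * x + 1) * (2 / (2 * x + 1)) =
      (3 * (2 * x + 1) * Real.log (2 * x + 1) - 2 * (3 * x + 1) * Real.log (3 * x + 1)) /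
        ((3 * x + 1) * (2 * x + 1)) := by
    field_simp
  rw [e]
  refine div_neg_of_neg_of_pos ?_ (by positivity)
  have h5 := mul_le_mul_of_nonneg_left h1 (show 0 ≤ 6 * x + 2 by positivity)
  linarith

theorem cast_numPieces (a : ℕ) : (numPieces a : ℝ) = 3 * a + 1 := by simp [numPieces]

theorem eq_of_increment_eq_zero {γ : ℝ} {a b : ℕ} (ha : 1 ≤ a) (hb : 1 ≤ b)
    (h1 : increment γ a = 0) (h2 : increment γ b = 0) : a = b := by
  have key : ∀ c : ℕ, 1 ≤ c → increment γ c = 0 →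
      Real.log (3 * (c : ℝ) + 1) / Real.log (2 * (c : ℝ) + 1) = γ := by
    intro c hc h
    have hc' : (1 : ℝ) ≤ c := by exact_mod_cast hc
    rw [increment, cast_numPieces, cast_scale, sub_eq_zero] at h
    rw [h, mul_div_cancel_right₀ _ (Real.log_pos (by linarith)).ne']
  have := strictAntiOn_log_div_log.injOn (Set.mem_Ici.2 (Nat.one_le_cast.2 ha))
    (Set.mem_Ici.2 (Nat.one_le_cast.2 hb)) ((key a ha h1).trans (key b hb h2).symm)
  exact_mod_cast this

/-! ### Deterministic consequences of the behaviour of the random walk -/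

theorem eventually_innerVolume_bounds {ξ : ℕ → ℕ} {B : ℕ} {γ k₁ k₂ K : ℝ}
    (hξ : ∀ n, 1 ≤ ξ n) (hB : ∀ n, ξ n ≤ B) (hk₁ : 0 < k₁) (hk₂ : 0 < k₂) (hK : 0 ≤ K)
    (hk : ∀ n : ℕ, ∀ ε : ℝ, 1 ≤ totalScale ξ n * ε → totalScale ξ n * ε ≤ 2 * B + 1 →
      k₁ * ε ^ (2 - γ) * Real.exp (∑ i ∈ Finset.range n, increment γ (ξ i)) ≤
        innerVolume (snowflake ξ) ε ∧
      innerVolume (snowflake ξ) ε ≤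
        k₂ * ε ^ (2 - γ) * Real.exp (∑ i ∈ Finset.range n, increment γ (ξ i)))
    (hS : ∀ᶠ n : ℕ in atTop,
      |∑ i ∈ Finset.range n, increment γ (ξ i)| ≤ K * √(n * Real.log (Real.log n))) :
    ∀ᶠ ε : ℝ in 𝓝[>] 0,
      k₁ * ε ^ (2 - γ) * Real.exp (-(K * psi (1 / ε))) ≤ innerVolume (snowflake ξ) ε ∧
      innerVolume (snowflake ξ) ε ≤ k₂ * ε ^ (2 - γ) * Real.exp (K * psi (1 / ε)) := by
  obtain ⟨N, hN⟩ := eventually_atTop.1 hS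
  filter_upwards [eventually_exists_scale hξ hB (max N 3), self_mem_nhdsWithin] with ε hε hε0
  obtain ⟨n, hn, h1, h2, h3⟩ := hε
  have hp : 0 < ε ^ (2 - γ) := Real.rpow_pos_of_pos hε0 _
  have h4 := abs_le.1 ((hN n (by omega)).trans
    (mul_le_mul_of_nonneg_left (sqrt_le_psi (by omega) h3) hK))
  obtain ⟨h5, h6⟩ := hk n ε h1 h2
  refine ⟨le_trans ?_ h5, h6.trans ?_⟩
  · have := Real.exp_le_exp.2 h4.1
    gcongr
  · have := Real.exp_le_exp.2 h4.2
    gcongr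

theorem tendsto_inv_totalScale_nhdsGT {ξ : ℕ → ℕ} (hξ : ∀ n, 1 ≤ ξ n) :
    Tendsto (fun n => (totalScale ξ n)⁻¹) atTop (𝓝[>] 0) :=
  tendsto_nhdsWithin_iff.2 ⟨tendsto_inv_totalScale hξ,
    Eventually.of_forall fun n => inv_pos.2 (totalScale_pos ξ n)⟩

/-- Evaluate along ε = 1/L_n at the infinitely many n where the walk is extreme: the excursion ±C√(n
log log n) beats c₄ ψ(L_n), leaving the constants k₂ and k₁ as bounds. -/
theorem liminf_limsup_innerVolume {ξ : ℕ → ℕ} {B : ℕ} {γ k₁ k₂ C c₄ : ℝ}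
    (hξ : ∀ n, 1 ≤ ξ n) (hB : ∀ n, ξ n ≤ B) (hk₁ : 0 < k₁) (hk₂ : 0 < k₂)
    (hk : ∀ n : ℕ, ∀ ε : ℝ, 1 ≤ totalScale ξ n * ε → totalScale ξ n * ε ≤ 2 * B + 1 →
      k₁ * ε ^ (2 - γ) * Real.exp (∑ i ∈ Finset.range n, increment γ (ξ i)) ≤
        innerVolume (snowflake ξ) ε ∧
      innerVolume (snowflake ξ) ε ≤
        k₂ * ε ^ (2 - γ) * Real.exp (∑ i ∈ Finset.range n, increment γ (ξ i)))
    (hc₄ : 0 < c₄) (hC : c₄ * √(2 * Real.log (2 * B + 1)) ≤ C)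
    (hpos : ∃ᶠ n : ℕ in atTop,
      C * √(n * Real.log (Real.log n)) ≤ ∑ i ∈ Finset.range n, increment γ (ξ i))
    (hneg : ∃ᶠ n : ℕ in atTop,
      C * √(n * Real.log (Real.log n)) ≤ ∑ i ∈ Finset.range n, -increment γ (ξ i)) :
    liminf (fun ε : ℝ => ((innerVolume (snowflake ξ) ε *
        Real.exp (c₄ * psi (1 / ε)) / ε ^ (2 - γ) : ℝ) : EReal)) (𝓝[>] 0) < ⊤ ∧
    0 < limsup (fun ε : ℝ => ((innerVolume (snowflake ξ) ε *
        Real.exp (-(c₄ * psi (1 / ε))) / ε ^ (2 - γ) : ℝ) : EReal)) (𝓝[>] 0) := by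
  have hL := totalScale_pos ξ
  have hpsi : ∀ᶠ n : ℕ in atTop,
      c₄ * psi (1 / (totalScale ξ n)⁻¹) ≤ C * √(n * Real.log (Real.log n)) := by
    filter_upwards [eventually_psi_le hξ hB] with n hn
    rw [one_div, inv_inv]
    calc c₄ * psi (totalScale ξ n)
        ≤ c₄ * (√(2 * Real.log (2 * B + 1)) * √(n * Real.log (Real.log n))) := by gcongr
      _ = c₄ * √(2 * Real.log (2 * B + 1)) * √(n * Real.log (Real.log n)) := by ring
      _ ≤ C * √(n * Real.log (Real.log n)) := by gcongr
  have hkn : ∀ n, _ := fun n => hk n (totalScale ξ n)⁻¹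
    (by rw [mul_inv_cancel₀ (hL n).ne']) (by
      rw [mul_inv_cancel₀ (hL n).ne']
      linarith [Nat.cast_nonneg (α := ℝ) B])
  constructor
  · refine lt_of_le_of_lt (liminf_le_of_frequently_le' (x := ((k₂ : ℝ) : EReal)) ?_)
      (EReal.coe_lt_top k₂)
    refine (tendsto_inv_totalScale_nhdsGT hξ).frequently ?_
    refine (hneg.and_eventually hpsi).mono ?_
    rintro n ⟨h1, h2⟩
    rw [Finset.sum_neg_distrib] at h1
    have hp : 0 < (totalScale ξ n)⁻¹ ^ (2 - γ) := Real.rpow_pos_of_pos (inv_pos.2 (hL n)) _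
    rw [EReal.coe_le_coe_iff, div_le_iff₀ hp]
    refine (mul_le_mul_of_nonneg_right (hkn n).2 (Real.exp_pos _).le).trans ?_
    rw [mul_assoc, ← Real.exp_add]
    refine mul_le_of_le_one_right (by positivity) (Real.exp_le_one_iff.2 ?_)
    linarith
  · refine lt_of_lt_of_le (EReal.coe_pos.2 hk₁) (le_limsup_of_frequently_le' ?_)
    refine (tendsto_inv_totalScale_nhdsGT hξ).frequently ?_
    refine (hpos.and_eventually hpsi).mono ?_
    rintro n ⟨h1, h2⟩
    have hp : 0 < (totalScale ξ n)⁻¹ ^ (2 - γ) := Real.rpow_pos_of_pos (inv_pos.2 (hL n)) _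
    rw [EReal.coe_le_coe_iff, le_div_iff₀ hp]
    refine le_trans ?_ (mul_le_mul_of_nonneg_right (hkn n).1 (Real.exp_pos _).le)
    rw [mul_assoc, ← Real.exp_add]
    refine le_mul_of_one_le_right (by positivity) (Real.one_le_exp ?_)
    linarith

end Snowflake

end

/-! ### The theorem: the centred walk and the assembly of the estimates. -/

theorem mainTheorem6 {Ω : Type*} [MeasurableSpace Ω] (P : Measure Ω) [IsProbabilityMeasure P]
    (A : Set ℕ) (hA : BddAbove A) (hA0 : ∀ a ∈ A, 1 ≤ a)
    (ξ : ℕ → Ω → ℕ) (hmeas : ∀ n, Measurable (ξ n)) (hmem : ∀ n, ∀ᵐ ω ∂P, ξ n ω ∈ A)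
    (hindep : iIndepFun ξ P) (hident : ∀ n, IdentDistrib (ξ n) (ξ 0) P P) :
    ∃ γ : ℝ,
      (∀ᵐ ω ∂P, Snowflake.HasInnerMinkowskiDim (Snowflake.snowflake (fun n => ξ n ω)) γ) ∧
      (∃ c₁ c₂ c₃ : ℝ, 0 < c₁ ∧ 0 < c₂ ∧ 0 < c₃ ∧
        ∀ᵐ ω ∂P, ∀ᶠ ε : ℝ in 𝓝[>] 0,
          c₁ * ε ^ (2 - γ) * Real.exp (-(c₂ * Snowflake.psi (1 / ε)))
              ≤ Snowflake.innerVolume (Snowflake.snowflake (fun n => ξ n ω)) ε ∧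
          Snowflake.innerVolume (Snowflake.snowflake (fun n => ξ n ω)) ε
              ≤ c₃ * ε ^ (2 - γ) * Real.exp (c₂ * Snowflake.psi (1 / ε))) ∧
      ((¬ ∃ a : ℕ, ∀ᵐ ω ∂P, ξ 0 ω = a) →
        ∃ c₄ : ℝ, 0 < c₄ ∧ ∀ᵐ ω ∂P,
          liminf (fun ε : ℝ =>
              ((Snowflake.innerVolume (Snowflake.snowflake (fun n => ξ n ω)) ε *
                Real.exp (c₄ * Snowflake.psi (1 / ε)) / ε ^ (2 - γ) : ℝ) : EReal)) (𝓝[>] 0) < ⊤ ∧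
          0 < limsup (fun ε : ℝ =>
              ((Snowflake.innerVolume (Snowflake.snowflake (fun n => ξ n ω)) ε *
                Real.exp (-(c₄ * Snowflake.psi (1 / ε))) / ε ^ (2 - γ) : ℝ) : EReal)) (𝓝[>] 0)) := by
  open Snowflake in
  obtain ⟨B, hB⟩ := hA
  have hξ : ∀ᵐ ω ∂P, (∀ n, 1 ≤ ξ n ω) ∧ ∀ n, ξ n ω ≤ B := by
    filter_upwards [ae_all_iff.2 hmem] with ω hω
    exact ⟨fun n => hA0 _ (hω n), fun n => hB (hω n)⟩
  have hmF : ∀ F : ℕ → ℝ, Measurable F := fun F => measurable_from_top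
  have hint : ∀ F : ℕ → ℝ, Integrable (fun ω => F (ξ 0 ω)) P := by
    intro F
    have hbd : ∀ᵐ ω ∂P, F (ξ 0 ω) ∈ Set.Icc (-∑ a ∈ Finset.range (B + 1), |F a|)
        (∑ a ∈ Finset.range (B + 1), |F a|) := by
      filter_upwards [hξ] with ω hω
      refine abs_le.1 (Finset.single_le_sum (f := fun a => |F a|) (fun a _ => abs_nonneg _) ?_)
      exact Finset.mem_range.2 (Nat.lt_succ_of_le (hω.2 0))
    exact Integrable.of_mem_Icc _ _ ((hmF F).comp (hmeas 0)).aemeasurable hbd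
  -- The only value for which the increments have mean zero; the denominator is at least log 3.
  set γ : ℝ := (∫ ω, Real.log (numPieces (ξ 0 ω)) ∂P) / ∫ ω, Real.log (scale (ξ 0 ω)) ∂P with hγ
  set X : ℕ → Ω → ℝ := fun n ω => increment γ (ξ n ω) with hX
  have hXm : ∀ n, Measurable (X n) := fun n => (hmF (increment γ)).comp (hmeas n)
  have hXindep : iIndepFun X P := hindep.comp (fun _ => increment γ) fun _ => hmF _
  have hXident : ∀ n, IdentDistrib (X n) (X 0) P P := fun n => (hident n).comp (hmF (increment γ))
  have hscale : 0 < ∫ ω, Real.log (scale (ξ 0 ω)) ∂P := by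
    have h1 : ∫ _, Real.log 3 ∂P ≤ ∫ ω, Real.log (scale (ξ 0 ω)) ∂P := by
      refine integral_mono_ae (integrable_const _) (hint fun a => Real.log (scale a)) ?_
      filter_upwards [hξ] with ω hω
      have : (1 : ℝ) ≤ ξ 0 ω := by exact_mod_cast hω.1 0
      refine Real.log_le_log (by norm_num) ?_
      rw [cast_scale]; linarith
    rw [integral_const, probReal_univ, one_smul] at h1
    linarith [log_three_gt]
  have hmean : ∀ n, ∫ ω, X n ω ∂P = 0 := by
    intro n
    rw [(hXident n).integral_eq]
    simp only [hX, increment]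
    rw [integral_sub (hint fun a => Real.log (numPieces a))
      ((hint fun a => Real.log (scale a)).const_mul γ), integral_const_mul, hγ,
      div_mul_cancel₀ _ hscale.ne', sub_self]
  -- The summand 1 keeps b, and hence the variance proxy, positive even if all increments vanish.
  set b : ℝ := 1 + ∑ a ∈ Finset.range (B + 1), |increment γ a| with hb
  have hb0 : 0 < b := by positivity
  have hbd : ∀ n, ∀ᵐ ω ∂P, X n ω ∈ Set.Icc (-b) b := by
    intro n
    filter_upwards [hξ] with ω hω
    refine abs_le.1 (le_trans (Finset.single_le_sum (f := fun a => |increment γ a|)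
      (fun a _ => abs_nonneg _) (Finset.mem_range.2 (Nat.lt_succ_of_le (hω.2 n)))) ?_)
    rw [hb]; linarith
  -- Hoeffding's lemma for centred bounded variables.
  have hsub := fun n =>
    hasSubgaussianMGF_of_mem_Icc_of_integral_eq_zero (hXm n).aemeasurable (hbd n) (hmean n)
  have hc : (0 : NNReal) < (‖b - -b‖₊ / 2) ^ 2 := by
    have : b - -b ≠ 0 := by linarith
    have := nnnorm_pos.2 this
    positivity
  generalize (‖b - -b‖₊ / 2) ^ 2 = c at hsub hc
  have hc' : (0 : ℝ) < c := hc
  have hnegindep : iIndepFun (fun n ω => -X n ω) P :=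
    hXindep.comp (fun _ x => -x) fun _ => measurable_neg
  have hnegmean : ∀ n, ∫ ω, -X n ω ∂P = 0 := fun n => by rw [integral_neg, hmean n, neg_zero]
  have hup := ae_eventually_sum_le (fun n => (hXm n).stronglyMeasurable) hXindep hsub hmean hc
  have hlow := ae_eventually_sum_le (X := fun n ω => -X n ω)
    (fun n => (hXm n).neg.stronglyMeasurable) hnegindep (fun n => (hsub n).neg) hnegmean hc
  obtain ⟨k₁, k₂, hk₁, hk₂, hk⟩ := exists_innerVolume_bounds B γ
  have hbounds : ∀ᵐ ω ∂P, ∀ᶠ ε : ℝ in 𝓝[>] 0,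
      k₁ * ε ^ (2 - γ) * Real.exp (-(4 * √c * psi (1 / ε))) ≤
        innerVolume (snowflake fun n => ξ n ω) ε ∧
      innerVolume (snowflake fun n => ξ n ω) ε ≤
        k₂ * ε ^ (2 - γ) * Real.exp (4 * √c * psi (1 / ε)) := by
    filter_upwards [hξ, hup, hlow] with ω hω h1 h2
    refine eventually_innerVolume_bounds hω.1 hω.2 hk₁ hk₂ (by positivity) (hk _ hω.1 hω.2) ?_
    filter_upwards [h1, h2] with n hn1 hn2
    rw [Finset.sum_neg_distrib] at hn2
    exact abs_le.2 ⟨by linarith, hn1⟩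
  refine ⟨γ, ?_, ⟨k₁, 4 * √c, k₂, hk₁, by positivity, hk₂, hbounds⟩, fun hconst => ?_⟩
  · filter_upwards [hbounds] with ω hω
    exact hasInnerMinkowskiDim_of_bounds hk₁ hk₂ hω
  -- Zero variance would make the increment vanish almost surely, and it vanishes at no more than
  -- one a ≥ 1.
  have hvar : variance (X 0) P ≠ 0 := by
    intro h0
    have h1 := ae_eq_integral_of_variance_eq_zero ((hsub 0).memLp 2) h0
    rw [hmean 0] at h1
    obtain ⟨ω₀, hω₀, h₀⟩ := (hξ.and h1).exists
    refine hconst ⟨ξ 0 ω₀, ?_⟩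
    filter_upwards [hξ, h1] with ω hω h
    exact eq_of_increment_eq_zero (hω.1 0) (hω₀.1 0) h h₀
  have hnegvar : variance (fun ω => -X 0 ω) P ≠ 0 := by
    rwa [variance_fun_neg]
  obtain ⟨C, hC0, hC⟩ := ae_frequently_le_sum hXm hXindep hXident hsub hmean hc hvar
  obtain ⟨C', hC0', hC'⟩ := ae_frequently_le_sum (X := fun n ω => -X n ω)
    (fun n => (hXm n).neg) hnegindep (fun n => (hXident n).comp measurable_neg)
    (fun n => (hsub n).neg) hnegmean hc hnegvar
  set s : ℝ := √(2 * Real.log (2 * B + 1)) with hs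
  have hs0 : 0 ≤ s := Real.sqrt_nonneg _
  -- Chosen so that c₄ s ≤ min C C'; the + 1 avoids a division by zero.
  refine ⟨min C C' / (s + 1), by positivity, ?_⟩
  filter_upwards [hξ, hC, hC'] with ω hω h1 h2
  refine liminf_limsup_innerVolume (C := min C C') hω.1 hω.2 hk₁ hk₂ (hk _ hω.1 hω.2)
    (by positivity) ?_ (h1.mono fun n hn => le_trans ?_ hn) (h2.mono fun n hn => le_trans ?_ hn)
  · rw [← hs, div_mul_eq_mul_div, div_le_iff₀ (by positivity)]
    have : 0 < min C C' := lt_min hC0 hC0'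
    nlinarith
  · gcongr; exact min_le_left _ _
  · gcongr; exact min_le_right _ _
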